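/- Assume the Exponential Time Hypothesis and the Projection Games Conjecture. Then there is a constant $c>0$ such that no polynomial-time algorithm is an $m^c$-approximation for Min Set Cover, where $m$ is the number of sets of the instance: that is, no deterministic algorithm which, given subsets $S_1,\dots,S_m$ of a finite set $U$ with $\bigcup_i S_i=U$, runs in time polynomial in the size of the input, always outputs $J\subseteq\{1,\dots,m\}$ such that $\bigcup_{j\in J}S_j=U$ and $|J|\le m^c\cdot\mathrm{opt}$, where $\mathrm{opt}$ is the least possible size of such a $J$. Here the size of a 3-CNF formula is its number of variables plus its number of clauses, and the two assumptions are the following. Exponential Time Hypothesis (ETH): no deterministic algorithm decides 3-SAT on formulas of size $n$ in time $2^{o(n)}$. Projection Games Conjecture (PGC): a projection game consists of a bipartite graph $(A,B,E)$ with $E\neq\emptyset$ (parallel edges allowed), non-empty finite alphabets $\Sigma_A,\Sigma_B$, and a map $\pi_e:\Sigma_A\to\Sigma_B$ for every $e\in E$; labellings $x:A\to\Sigma_A$, $y:B\to\Sigma_B$ satisfy the edge $e=(a,b)$ if $\pi_e(x(a))=y(b)$; the size of the game is $|A|+|B|+|E|$. The conjecture says that there are constants $c_0>0$ and $C\in\mathbb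 N$ such that for every function $k:\mathbb N\to\mathbb N$ that is computable in time polynomial in $n$ and satisfies $1\le k(n)\le\max(1,n^{c_0})$, with $\varepsilon(n)=1/k(n)$, there is a polynomial-time reduction that maps each 3-CNF formula $\varphi$ of size $n$ to a projection game of size at most $C\,(n+1)^{1+o(1)}\,k(n)^{C}$ with $|\Sigma_A|,|\Sigma_B|\le C\,k(n)^{C}$ (that is, of size $n^{1+o(1)}\mathrm{poly}(1/\varepsilon)$, over alphabets of size $\mathrm{poly}(1/\varepsilon)$), such that if $\varphi$ is satisfiable then some labelling satisfies all edges, and if $\varphi$ is unsatisfiable then every labelling satisfies at most an $\varepsilon(n)$ fraction of the edges. -/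

import Mathlib

open Filter Topology

namespace SetCoverHardness

/-! ### The machine model

Algorithms are programs of a small Lisp-like language whose only data are finite binary trees
(S-expressions over one atom): the classical WHILE model on trees. Elementary operations are
charged the size of the tree that they return, so that the cost dominates all the memory that is
written. The model and multi-tape Turing machines simulate each other with polynomial overhead;
hence "polynomial time" and "time `2 ^ o(n)`" have their usual meaning. -/

/-- Finite binary trees, the data of the machine model. -/
inductive Data : Type
  | leaf : Data
  | node (l r : Data) : Data

/-- The number of vertices of a tree. -/
def Data.size : Data → ℕ
  | .leaf => 1
  | .node l r => l.size + r.size + 1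

/-- Left subtree (`leaf` for a leaf). -/
def Data.fst : Data → Data
  | .leaf => .leaf
  | .node l _ => l

/-- Right subtree (`leaf` for a leaf). -/
def Data.snd : Data → Data
  | .leaf => .leaf
  | .node _ r => r

/-- Programs. Each one transforms one tree into one tree. `cond p f g` runs `f` if the result of
`p` is not `leaf` and `g` otherwise; `comp f g` runs `g` first; `loop f` is the while loop
"as long as the left subtree of the current tree is not `leaf`, apply `f` to the current tree". -/
inductive Code : Type
  | id : Code
  | nil : Code
  | left : Code
  | right : Code
  | pair (f g : Code) : Code
  | comp (f g : Code) : Code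
  | cond (p f g : Code) : Code
  | loop (f : Code) : Code

/-- `Eval c x y t`: the program `c`, started on `x`, halts with result `y` after time exactly
`t`. -/
inductive Eval : Code → Data → Data → ℕ → Prop
  | id (x : Data) : Eval .id x x x.size
  | nil (x : Data) : Eval .nil x .leaf 1
  | left (x : Data) : Eval .left x x.fst x.fst.size
  | right (x : Data) : Eval .right x x.snd x.snd.size
  | pair {f g : Code} {x y z : Data} {s t : ℕ} (hf : Eval f x y s) (hg : Eval g x z t) :
      Eval (.pair f g) x (.node y z) (s + t + 1)
  | comp {f g : Code} {x y z : Data} {s t : ℕ} (hg : Eval g x y s) (hf : Eval f y z t) :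
      Eval (.comp f g) x z (s + t + 1)
  | cond_true {p f g : Code} {x b y : Data} {s t : ℕ} (hp : Eval p x b s) (hb : b ≠ .leaf)
      (hf : Eval f x y t) : Eval (.cond p f g) x y (s + t + 1)
  | cond_false {p f g : Code} {x y : Data} {s t : ℕ} (hp : Eval p x .leaf s)
      (hg : Eval g x y t) : Eval (.cond p f g) x y (s + t + 1)
  | loop_stop {f : Code} {x : Data} (hx : x.fst = .leaf) : Eval (.loop f) x x x.size
  | loop_step {f : Code} {x y z : Data} {s t : ℕ} (hx : x.fst ≠ .leaf) (hf : Eval f x y s)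
      (hl : Eval (.loop f) y z t) : Eval (.loop f) x z (s + t + 1)

/-- Lists of (encoded) objects. -/
def encList : List Data → Data
  | [] => .leaf
  | a :: l => .node a (encList l)

/-- Natural numbers, in unary. -/
def encNat (n : ℕ) : Data := encList (List.replicate n .leaf)

/-- Truth values. -/
def encBool : Bool → Data
  | false => .leaf
  | true => .node .leaf .leaf

/-- The assignment `inp a ↦ out a` is computed by one program, in time polynomial in the size of
the input. -/
def PolyTime {α : Type} (inp out : α → Data) : Prop :=
  ∃ (M : Code) (p : Polynomial ℕ), ∀ a, ∃ t, t ≤ p.eval (inp a).size ∧ Eval M (inp a) (out a) t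

/-! ### 3-SAT and the Exponential Time Hypothesis -/

/-- A 3-CNF formula in the variables `0, …, numVars - 1`. A literal `(i, b)` says that variable `i`
has the value `b`. A clause has three literals, not necessarily different. -/
structure CNF3 : Type where
  numVars : ℕ
  clauses : List (Fin 3 → Fin numVars × Bool)

/-- The size of a formula: the number of its variables plus the number of its clauses. -/
def CNF3.size (φ : CNF3) : ℕ := φ.numVars + φ.clauses.length

def CNF3.Satisfiable (φ : CNF3) : Prop :=
  ∃ v : Fin φ.numVars → Bool, ∀ C ∈ φ.clauses, ∃ j : Fin 3, v (C j).1 = (C j).2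

def CNF3.enc (φ : CNF3) : Data :=
  .node (encNat φ.numVars) (encList (φ.clauses.map fun C =>
    encList (List.ofFn fun j => .node (encNat (C j).1) (encBool (C j).2))))

open Classical in
/-- `M` decides 3-SAT, and on formulas of size `n` it takes time at most `2 ^ f n`. -/
def DecidesSATInTime (M : Code) (f : ℕ → ℝ) : Prop :=
  ∀ φ : CNF3, ∃ t : ℕ, (t : ℝ) ≤ (2 : ℝ) ^ f φ.size ∧
    Eval M φ.enc (encBool (decide φ.Satisfiable)) t

/-- The Exponential Time Hypothesis: no algorithm decides 3-SAT on instances of size `n` in time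
`2 ^ o(n)`. -/
def ETH : Prop :=
  ¬ ∃ (M : Code) (f : ℕ → ℝ), f =o[atTop] (fun n : ℕ => (n : ℝ)) ∧ DecidesSATInTime M f

/-! ### Projection games -/

/-- An edge of a projection game with vertex sets `Fin a`, `Fin b` and alphabets `Fin s`, `Fin s'`,
together with its projection. -/
structure GameEdge (a b s s' : ℕ) : Type where
  src : Fin a
  tgt : Fin b
  proj : Fin s → Fin s'

/-- A projection game: a bipartite graph with sides `A` and `B` and at least one edge (parallel
edges are allowed), non-empty finite alphabets for `A` and for `B`, and for every edge a map from
the first alphabet to the second. -/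
structure ProjectionGame : Type where
  numA : ℕ
  numB : ℕ
  alphA : ℕ
  alphB : ℕ
  edges : List (GameEdge numA numB alphA alphB)
  alphA_pos : 0 < alphA
  alphB_pos : 0 < alphB
  edges_ne_nil : edges ≠ []

/-- The number of vertices plus the number of edges. -/
def ProjectionGame.size (G : ProjectionGame) : ℕ := G.numA + G.numB + G.edges.length

/-- The number of edges that a labelling of both sides satisfies. -/
def ProjectionGame.numSat (G : ProjectionGame) (x : Fin G.numA → Fin G.alphA)
    (y : Fin G.numB → Fin G.alphB) : ℕ :=
  G.edges.countP fun e => decide (e.proj (x e.src) = y e.tgt)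

def ProjectionGame.enc (G : ProjectionGame) : Data :=
  encList [encNat G.numA, encNat G.numB, encNat G.alphA, encNat G.alphB,
    encList (G.edges.map fun e =>
      encList [encNat e.src, encNat e.tgt,
        encList (List.ofFn fun s => encNat (e.proj s))])]

/-- The Projection Games Conjecture: there is `c > 0` such that for every error `ε ≥ 1 / n ^ c`,
3-SAT on inputs of size `n` can be reduced in polynomial time to projection games of size
`n ^ (1 + o(1)) * poly (1 / ε)` over alphabets of size `poly (1 / ε)`, with perfect completeness
and soundness error `ε`.

Here `ε = 1 / k n` for a function `k` that is computable in polynomial time, `poly (1 / ε)` is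
`C * k ^ C` with `C` independent of `k`, and `n + 1` avoids degenerate values at `n = 0`
and `n = 1`. -/
def ProjectionGamesConjecture : Prop :=
  ∃ c : ℝ, 0 < c ∧ ∃ C : ℕ,
    ∀ k : ℕ → ℕ, PolyTime encNat (fun n => encNat (k n)) →
      (∀ n, 1 ≤ k n ∧ (k n : ℝ) ≤ max 1 ((n : ℝ) ^ c)) →
      ∃ red : CNF3 → ProjectionGame, PolyTime CNF3.enc (fun φ => (red φ).enc) ∧
        ∃ o : ℕ → ℝ, Tendsto o atTop (𝓝 0) ∧
          ∀ φ : CNF3,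
            ((red φ).size : ℝ) ≤
              C * ((φ.size : ℝ) + 1) ^ (1 + o φ.size) * (k φ.size : ℝ) ^ C ∧
            (red φ).alphA ≤ C * k φ.size ^ C ∧
            (red φ).alphB ≤ C * k φ.size ^ C ∧
            (φ.Satisfiable → ∃ x y, (red φ).numSat x y = (red φ).edges.length) ∧
            (¬ φ.Satisfiable → ∀ x y,
              ((red φ).numSat x y : ℝ) ≤ (1 / (k φ.size : ℝ)) * (red φ).edges.length)

/-! ### Min Set Cover -/

/-- An instance of Min Set Cover: `numSets` subsets of a universe of `numElems` elements, whose
union is the universe. -/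
structure SetCover : Type where
  numElems : ℕ
  numSets : ℕ
  sets : Fin numSets → Finset (Fin numElems)
  feasible : ∀ u, ∃ i, u ∈ sets i

/-- A feasible solution: a collection of (indices of) sets that covers the universe. -/
def SetCover.IsCover (I : SetCover) (S : Finset (Fin I.numSets)) : Prop :=
  ∀ u, ∃ i ∈ S, u ∈ I.sets i

/-- The size of the universe and the incidence matrix, row by row. -/
def SetCover.enc (I : SetCover) : Data :=
  .node (encNat I.numElems) (encList (List.ofFn fun i =>
    encList (List.ofFn fun u => encBool (decide (u ∈ I.sets i)))))

/-- The indicator vector of a collection of sets. -/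
def SetCover.encSol (I : SetCover) (S : Finset (Fin I.numSets)) : Data :=
  encList (List.ofFn fun i => encBool (decide (i ∈ S)))

/-- There is a polynomial-time algorithm that finds, in every instance, a cover which is at most
`ρ m` times as large as any other cover, where `m` is the number of sets of the instance. -/
def HasPolyTimeApprox (ρ : ℕ → ℝ) : Prop :=
  ∃ sol : (I : SetCover) → Finset (Fin I.numSets),
    PolyTime SetCover.enc (fun I => I.encSol (sol I)) ∧
      ∀ I : SetCover, I.IsCover (sol I) ∧
        ∀ T, I.IsCover T → ((sol I).card : ℝ) ≤ ρ I.numSets * (T.card : ℝ)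

end SetCoverHardness

namespace SetCoverHardness

/-! ### Polynomial bounds -/

/-! The proof is a gap reduction from projection games to set cover, run within time `2 ^ O(√n)`. A
set is an edge with a label for each of its two ends. An element tests an edge `e`: it names an edge
`i₁` at the `A`-end of `e`, an edge `i₂` at the `B`-end, and a vector `u` of bits indexed by the
second alphabet. A set at `i₁` with `A`-label `σ` covers the element if `u` is 0 at `π_e(σ)`; a set
at `i₂` with `B`-label `τ` covers it if `u` is 1 at `τ`. All vectors `u` can be covered only if some
`σ` at `i₁` projects to some `τ` at `i₂`.

A perfect labelling thus gives a cover with one set per edge (`exists_cover_card_le`). Conversely,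
from a cover `S`, each vertex takes its list of candidate labels from its cheapest edge; random
choices from the lists, derandomised by averaging, satisfy at least `|E|³ / |S|²` edges
(`exists_numSat_ge`). Working with edges rather than vertices weights vertices by degree, so no
regularity is needed.

With soundness error `1 / J²` the gap in cover size is a factor `J`, where `J` is about `n ^ (1/r)`
for a large constant `r`. The number of sets is at most a fixed power `J ^ d`, so an `m ^
(1/(d+1))`-approximation decides 3-SAT. The universe has `2 ^ |Σ_B|` vectors per triple of edges;
the choice of `r` makes `|Σ_B| = O(√n)`, so the total time is `2 ^ O(√n)`, against ETH. The rest is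
a calculus of closure properties (`PolyTimeIn`) showing that every step is computable within a given
measure. -/

theorem eval_mono (p : Polynomial ℕ) {m n : ℕ} (h : m ≤ n) : p.eval m ≤ p.eval n := by
  simp only [Polynomial.eval_eq_sum, Polynomial.sum]
  gcongr

/-- `g` is bounded by a polynomial in `s`. -/
def PolyBounded {α : Type} (s g : α → ℕ) : Prop :=
  ∃ p : Polynomial ℕ, ∀ a, g a ≤ p.eval (s a)

namespace PolyBounded

variable {α β : Type} {s g h : α → ℕ}

theorem of_le (hg : PolyBounded s g) (hh : ∀ a, h a ≤ g a) : PolyBounded s h :=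
  hg.imp fun _ hp a => (hh a).trans (hp a)

theorem const (n : ℕ) : PolyBounded s (fun _ => n) :=
  ⟨Polynomial.C n, fun a => by simp⟩

theorem refl : PolyBounded s s := ⟨Polynomial.X, fun a => by simp⟩

theorem add (hg : PolyBounded s g) (hh : PolyBounded s h) :
    PolyBounded s (fun a => g a + h a) := by
  obtain ⟨p, hp⟩ := hg
  obtain ⟨q, hq⟩ := hh
  exact ⟨p + q, fun a => by simpa using Nat.add_le_add (hp a) (hq a)⟩

theorem mul (hg : PolyBounded s g) (hh : PolyBounded s h) :
    PolyBounded s (fun a => g a * h a) := by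
  obtain ⟨p, hp⟩ := hg
  obtain ⟨q, hq⟩ := hh
  exact ⟨p * q, fun a => by simpa using Nat.mul_le_mul (hp a) (hq a)⟩

theorem pow (hg : PolyBounded s g) (n : ℕ) : PolyBounded s (fun a => g a ^ n) := by
  obtain ⟨p, hp⟩ := hg
  exact ⟨p ^ n, fun a => by simpa using Nat.pow_le_pow_left (hp a) n⟩

theorem trans (hg : PolyBounded s g) (hh : PolyBounded g h) : PolyBounded s h := by
  obtain ⟨p, hp⟩ := hg
  obtain ⟨q, hq⟩ := hh
  exact ⟨q.comp p, fun a => by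
    simpa [Polynomial.eval_comp] using (hq a).trans (eval_mono q (hp a))⟩

theorem reindex (hg : PolyBounded s g) (r : β → α) :
    PolyBounded (fun b => s (r b)) (fun b => g (r b)) :=
  hg.imp fun _ hp b => hp (r b)

end PolyBounded

/-! ### Encodings -/

theorem Data.size_fst_le (x : Data) : x.fst.size ≤ x.size := by
  cases x <;> simp only [Data.size, Data.fst] <;> omega

theorem Data.size_snd_le (x : Data) : x.snd.size ≤ x.size := by
  cases x <;> simp only [Data.size, Data.snd] <;> omega

theorem encNat_succ (n : ℕ) : encNat (n + 1) = .node .leaf (encNat n) := by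
  simp [encNat, List.replicate_succ, encList]

theorem encNat_zero : encNat 0 = .leaf := by simp [encNat, encList]

theorem size_encNat (n : ℕ) : (encNat n).size = 2 * n + 1 := by
  induction n with
  | zero => simp [encNat_zero, Data.size]
  | succ n ih => simp only [encNat_succ, Data.size, ih]; omega

theorem encNat_length {β : Type} (l : List β) :
    encNat l.length = encList (l.map fun _ => Data.leaf) := by
  simp [encNat, List.map_const']

theorem snd_encNat (n : ℕ) : (encNat n).snd = encNat (n - 1) := by
  cases n <;> simp [encNat_zero, encNat_succ, Data.snd]

theorem size_le_of_mem {x : Data} {l : List Data} (h : x ∈ l) : x.size ≤ (encList l).size := by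
  induction l with
  | nil => simp at h
  | cons y l ih =>
    simp only [encList, Data.size]
    rcases List.mem_cons.1 h with rfl | h
    · omega
    · have := ih h; omega

theorem length_le_size_encList (l : List Data) : l.length ≤ (encList l).size := by
  induction l with
  | nil => simp
  | cons y l ih => simp only [encList, Data.size, List.length_cons]; omega

theorem size_encList_eq (l : List Data) :
    (encList l).size = (l.map Data.size).sum + l.length + 1 := by
  induction l with
  | nil => simp [encList, Data.size]
  | cons y l ih => simp only [encList, Data.size, ih, List.map_cons, List.sum_cons,
      List.length_cons]; omega

/-- Each operation is charged at least the size of its result, so a time bound is also an output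
size bound. -/
theorem Eval.size_le {c : Code} {x y : Data} {t : ℕ} (h : Eval c x y t) : y.size ≤ t := by
  induction h <;> (try simp only [Data.size] at *) <;> omega

/-! ### Polynomial time with respect to a measure -/

/-- One program computes `inp a ↦ out a`, in time polynomial in `s a`. -/
def PolyTimeIn {α : Type} (s : α → ℕ) (inp out : α → Data) : Prop :=
  ∃ (M : Code) (T : α → ℕ), PolyBounded s T ∧ ∀ a, Eval M (inp a) (out a) (T a)

namespace PolyTimeIn

variable {α β : Type} {s : α → ℕ} {inp f g h : α → Data}

theorem mk_of_le {M : Code} {T : α → ℕ} (hT : PolyBounded s T)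
    (hM : ∀ a, ∃ t, t ≤ T a ∧ Eval M (inp a) (f a) t) : PolyTimeIn s inp f := by
  choose t ht hM using hM
  exact ⟨M, t, hT.of_le ht, hM⟩

theorem _root_.SetCoverHardness.PolyTime.polyTimeIn (hf : PolyTime inp f) :
    PolyTimeIn (fun a => (inp a).size) inp f := by
  obtain ⟨M, p, hp⟩ := hf
  exact mk_of_le (T := fun a => p.eval (inp a).size) ⟨p, fun _ => le_rfl⟩ hp

theorem polyTime (hf : PolyTimeIn (fun a => (inp a).size) inp f) : PolyTime inp f := by
  obtain ⟨M, T, ⟨p, hp⟩, hM⟩ := hf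
  exact ⟨M, p, fun a => ⟨T a, hp a, hM a⟩⟩

theorem polyBounded (hf : PolyTimeIn s inp f) : PolyBounded s (fun a => (f a).size) := by
  obtain ⟨M, T, hT, hM⟩ := hf
  exact hT.of_le fun a => (hM a).size_le

theorem reindex (hf : PolyTimeIn s inp f) (r : β → α) :
    PolyTimeIn (fun b => s (r b)) (fun b => inp (r b)) (fun b => f (r b)) := by
  obtain ⟨M, T, hT, hM⟩ := hf
  exact ⟨M, _, hT.reindex r, fun b => hM (r b)⟩

theorem of_measure {s' : α → ℕ} (hf : PolyTimeIn s' inp f) (hs : PolyBounded s s') :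
    PolyTimeIn s inp f := by
  obtain ⟨M, T, hT, hM⟩ := hf
  exact ⟨M, T, hs.trans hT, hM⟩

theorem congr (hf : PolyTimeIn s inp f) (h : ∀ a, f a = g a) : PolyTimeIn s inp g := by
  rwa [← funext h]

theorem ident (hs : PolyBounded s (fun a => (inp a).size)) : PolyTimeIn s inp inp :=
  ⟨.id, _, hs, fun _ => .id _⟩

theorem nil : PolyTimeIn s inp (fun _ => .leaf) := ⟨.nil, _, .const 1, fun _ => .nil _⟩

theorem comp (hf : PolyTimeIn s inp f) (hg : PolyTimeIn s f g) : PolyTimeIn s inp g := by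
  obtain ⟨M, T, hT, hM⟩ := hf
  obtain ⟨M', T', hT', hM'⟩ := hg
  exact ⟨.comp M' M, _, (hT.add hT').add (.const 1), fun a => .comp (hM a) (hM' a)⟩

theorem node (hf : PolyTimeIn s inp f) (hg : PolyTimeIn s inp g) :
    PolyTimeIn s inp (fun a => .node (f a) (g a)) := by
  obtain ⟨M, T, hT, hM⟩ := hf
  obtain ⟨M', T', hT', hM'⟩ := hg
  exact ⟨.pair M M', _, (hT.add hT').add (.const 1), fun a => .pair (hM a) (hM' a)⟩

theorem fst (hf : PolyTimeIn s inp f) : PolyTimeIn s inp (fun a => (f a).fst) :=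
  hf.comp ⟨.left, _, hf.polyBounded.of_le fun a => (f a).size_fst_le, fun _ => .left _⟩

theorem snd (hf : PolyTimeIn s inp f) : PolyTimeIn s inp (fun a => (f a).snd) :=
  hf.comp ⟨.right, _, hf.polyBounded.of_le fun a => (f a).size_snd_le, fun _ => .right _⟩

theorem ite {p : α → Prop} [DecidablePred p] (hp : PolyTimeIn s inp h)
    (hph : ∀ a, h a ≠ .leaf ↔ p a) (hf : PolyTimeIn s inp f) (hg : PolyTimeIn s inp g) :
    PolyTimeIn s inp (fun a => if p a then f a else g a) := by
  obtain ⟨P, S, hS, hP⟩ := hp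
  obtain ⟨M, T, hT, hM⟩ := hf
  obtain ⟨M', T', hT', hM'⟩ := hg
  refine mk_of_le (M := .cond P M M') (T := fun a => S a + (T a + T' a) + 1)
    ((hS.add (hT.add hT')).add (.const 1)) fun a => ?_
  by_cases h' : p a
  · exact ⟨S a + T a + 1, by omega, by
      simpa [h'] using Eval.cond_true (hP a) ((hph a).2 h') (hM a)⟩
  · have h0 : h a = .leaf := by by_contra h0; exact h' ((hph a).1 h0)
    exact ⟨S a + T' a + 1, by omega, by
      simpa [h'] using Eval.cond_false (h0 ▸ hP a) (hM' a)⟩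

/-! #### Truth values -/

theorem encBool_ne_leaf {b : Bool} : encBool b ≠ .leaf ↔ b = true := by
  cases b <;> simp [encBool]

theorem cond {b : α → Bool} (hb : PolyTimeIn s inp (fun a => encBool (b a)))
    (hf : PolyTimeIn s inp f) (hg : PolyTimeIn s inp g) :
    PolyTimeIn s inp (fun a => if b a then f a else g a) :=
  ite hb (fun _ => encBool_ne_leaf) hf hg

theorem encBool_true : PolyTimeIn s inp (fun _ => encBool true) := nil.node nil

theorem encBool_false : PolyTimeIn s inp (fun _ => encBool false) := nil

theorem not {b : α → Bool} (hb : PolyTimeIn s inp (fun a => encBool (b a))) :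
    PolyTimeIn s inp (fun a => encBool (!b a)) :=
  (hb.cond encBool_false encBool_true).congr fun a => by cases b a <;> rfl

theorem and {b c : α → Bool} (hb : PolyTimeIn s inp (fun a => encBool (b a)))
    (hc : PolyTimeIn s inp (fun a => encBool (c a))) :
    PolyTimeIn s inp (fun a => encBool (b a && c a)) :=
  (hb.cond hc encBool_false).congr fun a => by cases b a <;> rfl

theorem or {b c : α → Bool} (hb : PolyTimeIn s inp (fun a => encBool (b a)))
    (hc : PolyTimeIn s inp (fun a => encBool (c a))) :
    PolyTimeIn s inp (fun a => encBool (b a || c a)) :=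
  (hb.cond encBool_true hc).congr fun a => by cases b a <;> rfl

/-- Comparison with a fixed tree. -/
theorem eq_const (hf : PolyTimeIn s inp f) (d : Data) {b : α → Bool}
    (hb : ∀ a, b a = true ↔ f a = d) : PolyTimeIn s inp (fun a => encBool (b a)) := by
  classical
  suffices h : PolyTimeIn s inp (fun a => encBool (decide (f a = d))) from
    h.congr fun a => by congr 1; rw [Bool.eq_iff_iff, hb]; simp
  clear hb b
  induction d generalizing f with
  | leaf =>
    refine (ite (p := fun a => f a ≠ .leaf) hf (fun _ => Iff.rfl) encBool_false
      encBool_true).congr fun a => ?_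
    by_cases h : f a = .leaf <;> simp [h]
  | node l r ihl ihr =>
    refine (ite (p := fun a => f a ≠ .leaf) hf (fun _ => Iff.rfl) ((ihl hf.fst).and (ihr hf.snd))
      encBool_false).congr fun a => ?_
    cases h : f a <;> simp [Data.fst, Data.snd]
    congr

/-! #### Loops -/

/-- The step is measured by `s a`, uniformly in the iteration `i`, so the costs of the `N a` rounds
add up and do not compound. -/
theorem loop {N : α → ℕ} {W : α → ℕ → Data} (hN : PolyBounded s N)
    (hlt : ∀ a, ∀ i < N a, (W a i).fst ≠ .leaf) (hend : ∀ a, (W a (N a)).fst = .leaf)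
    (hsize : PolyBounded s (fun a => (W a (N a)).size))
    (hstep : PolyTimeIn (fun q : {q : α × ℕ // q.2 < N q.1} => s q.1.1)
      (fun q => W q.1.1 q.1.2) (fun q => W q.1.1 (q.1.2 + 1))) :
    PolyTimeIn s (fun a => W a 0) (fun a => W a (N a)) := by
  obtain ⟨M, T, ⟨p, hp⟩, hM⟩ := hstep
  refine mk_of_le (M := .loop M)
    (T := fun a => N a * (p.eval (s a) + 1) + (W a (N a)).size)
    ((hN.mul (.add ⟨p, fun _ => le_rfl⟩ (.const 1))).add hsize) fun a => ?_
  -- Induction on the number `j` of rounds still to run.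
  have key : ∀ j i, i + j = N a → ∃ t, t ≤ j * (p.eval (s a) + 1) + (W a (N a)).size ∧
      Eval (.loop M) (W a i) (W a (N a)) t := by
    intro j
    induction j with
    | zero =>
      rintro i rfl
      exact ⟨(W a (N a)).size, by simp, by constructor; exact hend a⟩
    | succ j ih =>
      intro i hi
      obtain ⟨t, ht, h⟩ := ih (i + 1) (by omega)
      have hi' : i < N a := by omega
      have h1 := hp ⟨(a, i), hi'⟩
      refine ⟨_, ?_, .loop_step (hlt a i hi') (hM ⟨(a, i), hi'⟩) h⟩
      simp only [Nat.add_mul, one_mul] at ht ⊢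
      simp only at h1
      omega
  exact key (N a) 0 (by simp)

theorem iter {N : α → ℕ} {st : α → ℕ → Data} (hN : PolyTimeIn s inp (fun a => encNat (N a)))
    (h0 : PolyTimeIn s inp (fun a => st a 0))
    (hstep : PolyTimeIn (fun q : {q : α × ℕ // q.2 < N q.1} => s q.1.1)
      (fun q => st q.1.1 q.1.2) (fun q => st q.1.1 (q.1.2 + 1))) :
    PolyTimeIn s inp (fun a => st a (N a)) := by
  have hNb : PolyBounded s N := hN.polyBounded.of_le fun a => by
    rw [size_encNat]; omega
  obtain ⟨p0, hp0⟩ := h0.polyBounded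
  obtain ⟨p1, hp1⟩ := hstep.polyBounded
  have hst : ∀ a, ∀ i ≤ N a, (st a i).size ≤ (p0 + p1).eval (s a) := by
    intro a i hi
    rw [Polynomial.eval_add]
    cases i with
    | zero => exact (hp0 a).trans (Nat.le_add_right _ _)
    | succ i => exact (hp1 ⟨(a, i), hi⟩).trans (Nat.le_add_left _ _)
  -- The left subtree is a unary countdown, which is exactly what the while test inspects.
  let W : α → ℕ → Data := fun a i => .node (encNat (N a - i)) (st a i)
  have hW : PolyBounded (fun q : {q : α × ℕ // q.2 < N q.1} => s q.1.1)
      (fun q => (W q.1.1 q.1.2).size) := by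
    refine PolyBounded.of_le (g := fun q => (2 * N q.1.1 + 1) + (p0 + p1).eval (s q.1.1) + 1)
      ((((PolyBounded.const 2).mul (hNb.reindex _)).add (.const 1)).add
        ⟨p0 + p1, fun _ => le_rfl⟩ |>.add (.const 1)) fun q => ?_
    have := hst q.1.1 q.1.2 q.2.le
    simp only [W, Data.size, size_encNat]
    omega
  have hid := ident hW
  have hmain : PolyTimeIn s (fun a => W a 0) (fun a => W a (N a)) := by
    refine loop hNb (fun a i hi => ?_) (fun a => ?_) ?_ ?_
    · obtain ⟨j, hj⟩ : ∃ j, N a - i = j + 1 := ⟨N a - i - 1, by omega⟩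
      simp [W, Data.fst, hj, encNat_succ]
    · simp [W, Data.fst, encNat_zero]
    · refine PolyBounded.of_le (g := fun a => 1 + (p0 + p1).eval (s a) + 1)
        (((PolyBounded.const 1).add ⟨p0 + p1, fun _ => le_rfl⟩).add (.const 1)) fun a => ?_
      have := hst a (N a) le_rfl
      simp only [W, Data.size, Nat.sub_self, encNat_zero]
      omega
    · refine ((hid.fst.snd).node (hid.snd.comp hstep)).congr fun q => ?_
      simp only [W, Data.fst, snd_encNat, Nat.sub_sub]
  have h1 : PolyTimeIn s inp (fun a => W a 0) := (hN.node h0).congr fun a => by simp [W]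
  exact (h1.comp hmain).snd

/-- Results in an outer context remain available in an extended one. -/
theorem lift (hf : PolyTimeIn s inp f) {r : β → α} {inp' : β → Data}
    (hr : PolyTimeIn (fun b => s (r b)) inp' (fun b => inp (r b))) :
    PolyTimeIn (fun b => s (r b)) inp' (fun b => f (r b)) :=
  hr.comp (hf.reindex r)

theorem iterate_snd {N : α → ℕ} (hN : PolyTimeIn s inp (fun a => encNat (N a)))
    (hf : PolyTimeIn s inp f) : PolyTimeIn s inp (fun a => Data.snd^[N a] (f a)) := by
  have hsz : ∀ (x : Data) i, (Data.snd^[i] x).size ≤ x.size := by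
    intro x i
    induction i with
    | zero => simp
    | succ i ih =>
      rw [Function.iterate_succ_apply']
      exact (Data.size_snd_le _).trans ih
  refine iter (st := fun a i => Data.snd^[i] (f a)) hN hf ?_
  simp only [Function.iterate_succ_apply']
  exact (ident ((hf.polyBounded.reindex _).of_le fun q => hsz _ _)).snd

/-! #### Lists -/

theorem iterate_snd_encList (l : List Data) (n : ℕ) :
    Data.snd^[n] (encList l) = encList (l.drop n) := by
  induction n generalizing l with
  | zero => simp
  | succ n ih =>
    rw [Function.iterate_succ_apply]
    cases l with
    | nil => simpa [encList, Data.snd] using ih []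
    | cons x l => simpa [encList, Data.snd] using ih l

theorem getElem {N : α → ℕ} {l : α → List Data} (hl : PolyTimeIn s inp (fun a => encList (l a)))
    (hN : PolyTimeIn s inp (fun a => encNat (N a))) (h : ∀ a, (l a)[N a]? = some (f a)) :
    PolyTimeIn s inp f := by
  refine (iterate_snd hN hl).fst.congr fun a => ?_
  obtain ⟨h1, h2⟩ := List.getElem?_eq_some_iff.1 (h a)
  rw [iterate_snd_encList, List.drop_eq_getElem_cons h1, h2]
  rfl

theorem cons {l : α → List Data} (hf : PolyTimeIn s inp f)
    (hl : PolyTimeIn s inp (fun a => encList (l a))) :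
    PolyTimeIn s inp (fun a => encList (f a :: l a)) :=
  hf.node hl

theorem encList_nil : PolyTimeIn s inp (fun _ => encList []) := nil

/-- The loop consumes the list in the left subtree and carries the original input along with the
state. The step is an implication so that its proof may start from the readable context: current
item, input, state. -/
theorem fold {β : α → Type} {l : ∀ a, List (β a)} {e : ∀ a, β a → Data} {st : α → ℕ → Data}
    (hl : PolyTimeIn s inp (fun a => encList ((l a).map (e a))))
    (hin : PolyTimeIn s inp inp) (h0 : PolyTimeIn s inp (fun a => st a 0))
    (hsize : PolyBounded (fun q : {q : α × ℕ // q.2 ≤ (l q.1).length} => s q.1.1)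
      (fun q => (st q.1.1 q.1.2).size))
    (hstep : let s' : {q : α × ℕ // q.2 < (l q.1).length} → ℕ := fun q => s q.1.1
      let ctx : {q : α × ℕ // q.2 < (l q.1).length} → Data := fun q =>
        .node (e q.1.1 ((l q.1.1)[q.1.2]'q.2)) (.node (inp q.1.1) (st q.1.1 q.1.2))
      PolyTimeIn s' ctx ctx → PolyTimeIn s' ctx (fun q => st q.1.1 (q.1.2 + 1))) :
    PolyTimeIn s inp (fun a => st a (l a).length) := by
  let W : α → ℕ → Data := fun a i =>
    .node (encList (((l a).drop i).map (e a))) (.node (inp a) (st a i))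
  have hdrop : ∀ a i, (encList (((l a).drop i).map (e a))).size ≤
      (encList ((l a).map (e a))).size := by
    intro a i
    rw [List.map_drop, ← iterate_snd_encList]
    generalize encList ((l a).map (e a)) = x
    induction i with
    | zero => simp
    | succ i ih =>
      rw [Function.iterate_succ_apply']
      exact (Data.size_snd_le _).trans ih
  have hW : PolyBounded (fun q : {q : α × ℕ // q.2 ≤ (l q.1).length} => s q.1.1)
      (fun q => (W q.1.1 q.1.2).size) := by
    refine ((((hl.polyBounded.reindex (fun q : {q : α × ℕ // q.2 ≤ (l q.1).length} =>
      q.1.1)).add (hin.polyBounded.reindex _)).add hsize).add (.const 2)).of_le fun q => ?_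
    have := hdrop q.1.1 q.1.2
    simp only [W, Data.size]
    omega
  have hid := ident (hW.reindex (fun q : {q : α × ℕ // q.2 < (l q.1).length} =>
    (⟨q.1, q.2.le⟩ : {q : α × ℕ // q.2 ≤ (l q.1).length})))
  have hcons : ∀ q : {q : α × ℕ // q.2 < (l q.1).length},
      ((l q.1.1).drop q.1.2).map (e q.1.1) = e q.1.1 ((l q.1.1)[q.1.2]'q.2) ::
        ((l q.1.1).drop (q.1.2 + 1)).map (e q.1.1) := fun q => by
    rw [List.drop_eq_getElem_cons q.2, List.map_cons]
  have h1 : PolyTimeIn s inp (fun a => W a 0) := (hl.node (hin.node h0)).congr fun a => by simp [W]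
  refine (h1.comp (loop (W := W) ?_ (fun a i hi => ?_) (fun a => ?_) ?_ ?_)).snd.snd
  · exact hl.polyBounded.of_le fun a => by
      simpa using length_le_size_encList ((l a).map (e a))
  · have := hcons ⟨(a, i), hi⟩
    simp only at this
    simp [W, this, encList, Data.fst]
  · simp [W, encList, Data.fst]
  · exact hW.reindex (fun a => (⟨(a, (l a).length), le_rfl⟩ :
      {q : α × ℕ // q.2 ≤ (l q.1).length}))
  · have hctx : PolyTimeIn (fun q : {q : α × ℕ // q.2 < (l q.1).length} => s q.1.1)
        (fun q => W q.1.1 q.1.2) (fun q => .node (e q.1.1 ((l q.1.1)[q.1.2]'q.2))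
          (.node (inp q.1.1) (st q.1.1 q.1.2))) :=
      (hid.fst.fst.node hid.snd).congr fun q => by
        simp only [W, hcons q]
        rfl
    refine (hid.fst.snd.node (hid.snd.fst.node
      (hctx.comp (hstep (ident hctx.polyBounded))))).congr fun q => ?_
    simp only [W, hcons q]
    rfl

/-- Pushing images onto an accumulator reverses the order; `reverse`, `append` and `map` all come
from this one fold. -/
theorem revMap_append {β : α → Type} {l : ∀ a, List (β a)}
    {e f : ∀ a, β a → Data} {l₀ : α → List Data}
    (hl : PolyTimeIn s inp (fun a => encList ((l a).map (e a))))
    (hin : PolyTimeIn s inp inp) (h0 : PolyTimeIn s inp (fun a => encList (l₀ a)))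
    (hf : let s' : {q : Σ a, β a // q.2 ∈ l q.1} → ℕ := fun q => s q.1.1
      let ctx : {q : Σ a, β a // q.2 ∈ l q.1} → Data := fun q => .node (e q.1.1 q.1.2) (inp q.1.1)
      PolyTimeIn s' ctx ctx → PolyTimeIn s' ctx (fun q => f q.1.1 q.1.2)) :
    PolyTimeIn s inp (fun a => encList (((l a).map (f a)).reverse ++ l₀ a)) := by
  have hctx : PolyBounded (fun q : {q : Σ a, β a // q.2 ∈ l q.1} => s q.1.1)
      (fun q => (Data.node (e q.1.1 q.1.2) (inp q.1.1)).size) := by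
    refine (((hl.polyBounded.reindex (fun q : {q : Σ a, β a // q.2 ∈ l q.1} =>
      q.1.1)).add (hin.polyBounded.reindex _)).add (.const 1)).of_le fun q => ?_
    have := size_le_of_mem (List.mem_map_of_mem (f := e q.1.1) q.2)
    simp only [Data.size]
    omega
  replace hf := hf (ident hctx)
  obtain ⟨p, hp⟩ := hf.polyBounded
  have hlen : PolyBounded s (fun a => (l a).length) := hl.polyBounded.of_le fun a => by
    simpa using length_le_size_encList ((l a).map (e a))
  refine (fold (st := fun a i => encList ((((l a).take i).map (f a)).reverse ++ l₀ a)) hl hin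
    (h0.congr fun a => by simp) ?_ fun h => ?_).congr fun a => by simp
  · refine ((((hlen.mul (g := fun a => (l a).length) (h := fun a => p.eval (s a) + 1)
      (.add ⟨p, fun _ => le_rfl⟩ (.const 1))).add h0.polyBounded).reindex
      (fun q : {q : α × ℕ // q.2 ≤ (l q.1).length} => q.1.1))).of_le fun q => ?_
    have key : ∀ (L L' : List Data) (b : ℕ), (∀ x ∈ L, x.size ≤ b) →
        (encList (L.reverse ++ L')).size ≤ L.length * (b + 1) + (encList L').size := by
      intro L
      induction L with
      | nil => intro L' b _; simp
      | cons x L ih =>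
        intro L' b hb
        have h1 := ih (x :: L') b fun y hy => hb y (List.mem_cons_of_mem _ hy)
        have h2 := hb x List.mem_cons_self
        simp only [List.reverse_cons, List.append_assoc, List.singleton_append, List.length_cons,
          encList, Data.size, Nat.add_mul] at h1 ⊢
        omega
    refine (key (((l q.1.1).take q.1.2).map (f q.1.1)) (l₀ q.1.1) (p.eval (s q.1.1)) ?_).trans ?_
    · intro x hx
      obtain ⟨y, hy, rfl⟩ := List.mem_map.1 hx
      exact hp ⟨⟨q.1.1, y⟩, List.mem_of_mem_take hy⟩
    · simp only [List.length_map, List.length_take]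
      gcongr
      exact Nat.min_le_right _ _
  · have h1 := (h.fst.node h.snd.fst).comp (hf.reindex
      fun q : {q : α × ℕ // q.2 < (l q.1).length} =>
        (⟨⟨q.1.1, (l q.1.1)[q.1.2]'q.2⟩, List.getElem_mem _⟩ : {q : Σ a, β a // q.2 ∈ l q.1}))
    refine (h1.node h.snd.snd).congr fun q => ?_
    simp only [List.take_succ_eq_append_getElem q.2, List.map_append, List.reverse_append]
    rfl

theorem reverse {l : α → List Data} (hl : PolyTimeIn s inp (fun a => encList (l a)))
    (hin : PolyTimeIn s inp inp) : PolyTimeIn s inp (fun a => encList (l a).reverse) :=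
  (revMap_append (e := fun _ x => x) (f := fun _ x => x) (l := l) (l₀ := fun _ => [])
    (by simpa using hl) hin nil fun h => h.fst).congr fun a => by simp

theorem append {l l' : α → List Data} (hl : PolyTimeIn s inp (fun a => encList (l a)))
    (hl' : PolyTimeIn s inp (fun a => encList (l' a))) (hin : PolyTimeIn s inp inp) :
    PolyTimeIn s inp (fun a => encList (l a ++ l' a)) :=
  (revMap_append (e := fun _ x => x) (f := fun _ x => x) (l := fun a => (l a).reverse) (l₀ := l')
    (by simpa using hl.reverse hin) hin hl' fun h => h.fst).congr fun a => by simp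

theorem map {β : α → Type} {l : ∀ a, List (β a)} {e f : ∀ a, β a → Data}
    (hl : PolyTimeIn s inp (fun a => encList ((l a).map (e a)))) (hin : PolyTimeIn s inp inp)
    (hf : let s' : {q : Σ a, β a // q.2 ∈ l q.1} → ℕ := fun q => s q.1.1
      let ctx : {q : Σ a, β a // q.2 ∈ l q.1} → Data := fun q => .node (e q.1.1 q.1.2) (inp q.1.1)
      PolyTimeIn s' ctx ctx → PolyTimeIn s' ctx (fun q => f q.1.1 q.1.2)) :
    PolyTimeIn s inp (fun a => encList ((l a).map (f a))) :=
  (reverse (revMap_append (l₀ := fun _ => []) hl hin nil hf) hin).congr fun a => by simp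

theorem flatten {L : α → List (List Data)}
    (hL : PolyTimeIn s inp (fun a => encList ((L a).map encList))) (hin : PolyTimeIn s inp inp) :
    PolyTimeIn s inp (fun a => encList (L a).flatten) := by
  -- Bounds the partial results: each is the flattening of a suffix, no larger than the nested
  -- input.
  have key : ∀ K : List (List Data), (encList K.flatten).size ≤ (encList (K.map encList)).size := by
    intro K
    induction K with
    | nil => simp
    | cons l K ih =>
      rw [size_encList_eq] at ih ⊢
      simp only [List.flatten_cons, List.map_append, List.sum_append, List.length_append,
        List.map_cons, encList, Data.size, size_encList_eq l]
      omega
  have hrev : PolyTimeIn s inp (fun a => encList ((L a).reverse.map encList)) :=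
    (hL.reverse hin).congr fun a => by simp
  refine (fold (st := fun a i => encList ((L a).reverse.take i).reverse.flatten) hrev hin
    (nil.congr fun a => by simp [encList]) ?_ fun h => ?_).congr fun a => by
      rw [List.take_of_length_le le_rfl, List.reverse_reverse]
  · refine (hL.polyBounded.reindex _).of_le fun q => (key _).trans ?_
    rw [List.take_reverse, List.reverse_reverse, List.map_drop, ← iterate_snd_encList]
    generalize encList ((L q.1.1).map encList) = x
    generalize (L q.1.1).length - q.1.2 = i
    induction i with
    | zero => simp
    | succ i ih =>
      rw [Function.iterate_succ_apply']
      exact (Data.size_snd_le _).trans ih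
  · refine (append h.fst h.snd.snd h).congr fun q => ?_
    rw [List.take_succ_eq_append_getElem q.2]
    simp

theorem filter {β : α → Type} {l : ∀ a, List (β a)} {e : ∀ a, β a → Data} {b : ∀ a, β a → Bool}
    (hl : PolyTimeIn s inp (fun a => encList ((l a).map (e a)))) (hin : PolyTimeIn s inp inp)
    (hb : let s' : {q : Σ a, β a // q.2 ∈ l q.1} → ℕ := fun q => s q.1.1
      let ctx : {q : Σ a, β a // q.2 ∈ l q.1} → Data := fun q => .node (e q.1.1 q.1.2) (inp q.1.1)
      PolyTimeIn s' ctx ctx → PolyTimeIn s' ctx (fun q => encBool (b q.1.1 q.1.2))) :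
    PolyTimeIn s inp (fun a => encList (((l a).filter (b a)).map (e a))) := by
  have h1 : PolyTimeIn s inp (fun a => encList ((l a).map fun x =>
      encList (if b a x then [e a x] else []))) :=
    map hl hin fun h => ((hb h).cond (h.fst.cons encList_nil) encList_nil).congr fun q => by
      split_ifs <;> rfl
  refine (flatten (L := fun a => (l a).map fun x => if b a x then [e a x] else [])
    (h1.congr fun a => by rw [List.map_map]; rfl) hin).congr fun a => ?_
  congr 1
  induction l a with
  | nil => rfl
  | cons x l ih =>
    simp only [List.map_cons, List.flatten_cons, ih, List.filter_cons]
    split_ifs <;> simp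

theorem product {β γ : α → Type} {l : ∀ a, List (β a)} {l' : ∀ a, List (γ a)}
    {e : ∀ a, β a → Data} {e' : ∀ a, γ a → Data}
    (hl : PolyTimeIn s inp (fun a => encList ((l a).map (e a))))
    (hl' : PolyTimeIn s inp (fun a => encList ((l' a).map (e' a)))) (hin : PolyTimeIn s inp inp) :
    PolyTimeIn s inp (fun a => encList ((l a ×ˢ l' a).map fun x =>
      .node (e a x.1) (e' a x.2))) := by
  have h1 : PolyTimeIn s inp (fun a => encList ((l a).map fun x =>
      encList ((l' a).map fun y => .node (e a x) (e' a y)))) := by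
    refine map hl hin fun h => ?_
    refine map (l := fun q => l' q.1.1) (e := fun q => e' q.1.1)
      (f := fun q y => .node (e q.1.1 q.1.2) (e' q.1.1 y)) (hl'.lift h.snd) h fun h' => ?_
    exact h'.snd.fst.node h'.fst
  refine (flatten (L := fun a => (l a).map fun x => (l' a).map fun y => .node (e a x) (e' a y))
    (h1.congr fun a => by rw [List.map_map]; rfl) hin).congr fun a => ?_
  congr 1
  simp only [SProd.sprod, List.product, List.map_flatMap, List.map_map, ← List.flatMap_def]
  rfl

/-! #### Unary arithmetic -/

theorem length {β : α → Type} {l : ∀ a, List (β a)} {e : ∀ a, β a → Data}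
    (hl : PolyTimeIn s inp (fun a => encList ((l a).map (e a)))) (hin : PolyTimeIn s inp inp) :
    PolyTimeIn s inp (fun a => encNat (l a).length) :=
  (map (f := fun _ _ => .leaf) hl hin fun _ => nil).congr fun _ => (encNat_length _).symm

section Nat

variable {m n : α → ℕ}

theorem natSucc (hm : PolyTimeIn s inp (fun a => encNat (m a))) :
    PolyTimeIn s inp (fun a => encNat (m a + 1)) :=
  (nil.node hm).congr fun _ => (encNat_succ _).symm

theorem natConst (n : ℕ) : PolyTimeIn s inp (fun _ => encNat n) := by
  induction n with
  | zero => exact nil.congr fun _ => encNat_zero.symm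
  | succ n ih => exact ih.natSucc

theorem natMul (hm : PolyTimeIn s inp (fun a => encNat (m a)))
    (hn : PolyTimeIn s inp (fun a => encNat (n a))) (hin : PolyTimeIn s inp inp) :
    PolyTimeIn s inp (fun a => encNat (m a * n a)) := by
  refine (length (product (l := fun a => List.replicate (m a) ()) (e := fun _ _ => .leaf)
    (l' := fun a => List.replicate (n a) ()) (e' := fun _ _ => .leaf)
    (hm.congr fun a => ?_) (hn.congr fun a => ?_) hin) hin).congr fun a => ?_
  · rw [encNat, List.map_replicate]
  · rw [encNat, List.map_replicate]
  · rw [List.length_product, List.length_replicate, List.length_replicate]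

theorem natAdd (hm : PolyTimeIn s inp (fun a => encNat (m a)))
    (hn : PolyTimeIn s inp (fun a => encNat (n a))) (hin : PolyTimeIn s inp inp) :
    PolyTimeIn s inp (fun a => encNat (m a + n a)) :=
  (append hm hn hin).congr fun a => by rw [List.replicate_append_replicate]; rfl

theorem natPow (hm : PolyTimeIn s inp (fun a => encNat (m a))) (hin : PolyTimeIn s inp inp)
    (r : ℕ) : PolyTimeIn s inp (fun a => encNat (m a ^ r)) := by
  induction r with
  | zero => simpa using natConst 1
  | succ r ih => simpa only [pow_succ] using ih.natMul hm hin

theorem natLE (hm : PolyTimeIn s inp (fun a => encNat (m a)))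
    (hn : PolyTimeIn s inp (fun a => encNat (n a))) :
    PolyTimeIn s inp (fun a => encBool (decide (m a ≤ n a))) := by
  refine eq_const (iterate_snd hn hm) .leaf fun a => ?_
  -- Dropping `n` items is truncated subtraction, which vanishes exactly when `m ≤ n`.
  have : Data.snd^[n a] (encNat (m a)) = encNat (m a - n a) := by
    rw [encNat, iterate_snd_encList, List.drop_replicate]; rfl
  rw [this, decide_eq_true_iff]
  rcases Nat.eq_zero_or_pos (m a - n a) with h | h
  · simp only [h, encNat_zero, iff_true]; omega
  · obtain ⟨j, hj⟩ : ∃ j, m a - n a = j + 1 := ⟨m a - n a - 1, by omega⟩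
    simp only [hj, encNat_succ, reduceCtorEq, iff_false]; omega

theorem natEq (hm : PolyTimeIn s inp (fun a => encNat (m a)))
    (hn : PolyTimeIn s inp (fun a => encNat (n a))) :
    PolyTimeIn s inp (fun a => encBool (decide (m a = n a))) :=
  ((natLE hm hn).and (natLE hn hm)).congr fun a => by
    rw [← Bool.decide_and]; congr 2; exact propext antisymm_iff

theorem range (hn : PolyTimeIn s inp (fun a => encNat (n a))) (hin : PolyTimeIn s inp inp) :
    PolyTimeIn s inp (fun a => encList ((List.range (n a)).map encNat)) := by
  have h1 : PolyTimeIn s inp (fun a => Data.node (encNat (n a))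
      (encList (((List.range (n a)).map encNat).reverse))) := by
    refine iter (st := fun _ i => .node (encNat i) (encList ((List.range i).map encNat).reverse))
      hn ((natConst 0).node nil) ?_
    have hnb : PolyBounded s n := hn.polyBounded.of_le fun a => by rw [size_encNat]; omega
    have hsz : ∀ i, (encList ((List.range i).map encNat).reverse).size ≤ i * (2 * i + 2) + 1 := by
      intro i
      induction i with
      | zero => simp [encList, Data.size]
      | succ i ih =>
        simp only [List.range_succ, List.map_append, List.map_cons, List.map_nil,
          List.reverse_append, List.reverse_cons, List.reverse_nil, List.nil_append,
          List.singleton_append, encList, Data.size, size_encNat]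
        nlinarith
    have hid : PolyTimeIn (fun q : {q : α × ℕ // q.2 < n q.1} => s q.1.1)
        (fun q => Data.node (encNat q.1.2) (encList ((List.range q.1.2).map encNat).reverse)) _ :=
      ident <| (((((PolyBounded.const 2).mul hnb).add (.const 1)).add
        ((hnb.mul (((PolyBounded.const 2).mul hnb).add (.const 2))).add (.const 1))).add
        (.const 1) |>.reindex _).of_le fun q => by
          have h1 := hsz q.1.2
          have h2 := q.2
          have h3 : q.1.2 * (2 * q.1.2 + 2) ≤ n q.1.1 * (2 * n q.1.1 + 2) := by gcongr
          simp only [Data.size, size_encNat]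
          omega
    refine (hid.fst.natSucc.node (hid.fst.node hid.snd)).congr fun q => ?_
    simp [List.range_succ, encList, Data.fst, Data.snd]
  exact (h1.snd.reverse hin).congr fun a => by simp

end Nat

end PolyTimeIn
/-! ### The set cover instance of a projection game -/

theorem mem_sprod {β γ : Type} {l : List β} {l' : List γ} {x : β × γ} :
    x ∈ l ×ˢ l' ↔ x.1 ∈ l ∧ x.2 ∈ l' :=
  List.pair_mem_product

/-- All lists of `n` truth values. -/
def bitLists : ℕ → List (List Bool)
  | 0 => [[]]
  | n + 1 => ([true, false] ×ˢ bitLists n).map fun x => x.1 :: x.2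

theorem length_of_mem_bitLists {n : ℕ} {u : List Bool} (hu : u ∈ bitLists n) : u.length = n := by
  induction n generalizing u with
  | zero => simp_all [bitLists]
  | succ n ih =>
    simp only [bitLists, List.mem_map, mem_sprod] at hu
    obtain ⟨x, ⟨_, hx⟩, rfl⟩ := hu
    simp [ih hx]

theorem map_range_mem_bitLists (n : ℕ) (P : ℕ → Bool) : (List.range n).map P ∈ bitLists n := by
  induction n generalizing P with
  | zero => simp [bitLists]
  | succ n ih =>
    rw [List.range_succ_eq_map, List.map_cons, List.map_map]
    simp only [bitLists, List.mem_map, mem_sprod]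
    exact ⟨(P 0, _), ⟨by cases P 0 <;> simp, ih (P ∘ Nat.succ)⟩, rfl⟩

theorem length_bitLists (n : ℕ) : (bitLists n).length = 2 ^ n := by
  induction n with
  | zero => simp [bitLists]
  | succ n ih => rw [bitLists, List.length_map, List.length_product, ih, pow_succ']; rfl

def encBits (u : List Bool) : Data := encList (u.map encBool)

theorem size_encBits_le (u : List Bool) : (encBits u).size ≤ 4 * u.length + 1 := by
  induction u with
  | nil => simp [encBits, encList, Data.size]
  | cons b u ih =>
    have : (encBool b).size ≤ 3 := by cases b <;> simp [encBool, Data.size]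
    simp only [encBits, List.map_cons, encList, Data.size, List.length_cons] at ih ⊢
    omega

theorem size_encList_le {l : List Data} {b : ℕ} (h : ∀ x ∈ l, x.size ≤ b) :
    (encList l).size ≤ l.length * (b + 1) + 1 := by
  rw [size_encList_eq]
  have := List.sum_le_card_nsmul (l.map Data.size) b (by simpa using h)
  simp only [List.length_map, smul_eq_mul] at this
  linarith

theorem PolyTimeIn.bitLists {α : Type} {s : α → ℕ} {inp : α → Data} {n : α → ℕ}
    (hn : PolyTimeIn s inp (fun a => encNat (n a))) (hexp : PolyBounded s (fun a => 2 ^ n a)) :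
    PolyTimeIn s inp (fun a => encList ((bitLists (n a)).map encBits)) := by
  refine iter (st := fun _ i => encList ((SetCoverHardness.bitLists i).map encBits)) hn
    ((nil.cons encList_nil).congr fun a => rfl) ?_
  have hid := ident (s := fun q : {q : α × ℕ // q.2 < n q.1} => s q.1.1)
    (inp := fun q => encList ((SetCoverHardness.bitLists q.1.2).map encBits)) <|
    ((hexp.mul (((PolyBounded.const 4).mul hexp).add (.const 2))).add (.const 1) |>.reindex
      fun q : {q : α × ℕ // q.2 < n q.1} => q.1.1).of_le fun q => by
        refine (size_encList_le (b := 4 * q.1.2 + 1) ?_).trans ?_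
        · intro x hx
          obtain ⟨u, hu, rfl⟩ := List.mem_map.1 hx
          simpa [length_of_mem_bitLists hu] using size_encBits_le u
        · rw [List.length_map, length_bitLists]
          have h1 : q.1.2 ≤ n q.1.1 := q.2.le
          have h2 : n q.1.1 ≤ 2 ^ n q.1.1 := Nat.lt_two_pow_self.le
          have h3 : 2 ^ q.1.2 ≤ 2 ^ n q.1.1 := Nat.pow_le_pow_right (by norm_num) h1
          gcongr ?_ * ?_ + 1
          omega
  refine (product (l := fun _ => [true, false]) (e := fun _ => encBool)
    (encBool_true.cons (encBool_false.cons encList_nil)) hid hid).congr fun q => ?_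
  simp only [SetCoverHardness.bitLists, List.map_map]
  rfl

/-! ### The reduction from projection games to set cover -/

namespace ProjectionGame

variable (G : ProjectionGame)

abbrev Edge : Type := Fin G.edges.length

def edge (i : G.Edge) : GameEdge G.numA G.numB G.alphA G.alphB := G.edges[i]

/-- A test point `(i₁, e, i₂, u)`: it asks whether the labels of the edges `i₁` and `i₂` are
consistent along `e`. -/
abbrev Point : Type := G.Edge × G.Edge × G.Edge × List Bool

abbrev Label : Type := G.Edge × Fin G.alphA × Fin G.alphB

/-- Triples of edges without the required common ends are kept, so that this is a plain product;
`incident` puts their points into every set. -/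
def points : List G.Point :=
  List.finRange _ ×ˢ List.finRange _ ×ˢ List.finRange _ ×ˢ bitLists G.alphB

def labels : List G.Label := List.finRange _ ×ˢ List.finRange _ ×ˢ List.finRange _

/-- The set of the label `t` contains the test point `v`. -/
def incident (t : G.Label) (v : G.Point) : Bool :=
  !(decide ((G.edge v.1).src.val = (G.edge v.2.1).src.val) &&
      decide ((G.edge v.2.2.1).tgt.val = (G.edge v.2.1).tgt.val)) ||
    ((decide (t.1.val = v.1.val) &&
        !v.2.2.2.getD ((G.edge v.2.1).proj t.2.1) false) ||
      (decide (t.1.val = v.2.2.1.val) && v.2.2.2.getD t.2.2 false))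

variable {G}

theorem mem_labels (t : G.Label) : t ∈ G.labels := by
  simp [labels, mem_sprod]

theorem mem_points {v : G.Point} : v ∈ G.points ↔ v.2.2.2 ∈ bitLists G.alphB := by
  simp [points, mem_sprod]

/-- For any `σ`, pair it with its projection along `e`: the bit of `u` there decides whether the set
at `i` or at `i'` covers. -/
theorem exists_incident (v : G.Point) : ∃ t, G.incident t v := by
  rcases v with ⟨i, e, i', u⟩
  let σ : Fin G.alphA := ⟨0, G.alphA_pos⟩
  cases h : u.getD ((G.edge e).proj σ) false with
  | false => exact ⟨(i, σ, (G.edge e).proj σ), by simp only [incident, h]; simp⟩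
  | true => exact ⟨(i', σ, (G.edge e).proj σ), by simp only [incident, h]; simp⟩

variable (G) in
def setCover : SetCover where
  numElems := G.points.length
  numSets := G.labels.length
  sets i := {u | G.incident G.labels[i] G.points[u]}
  feasible u := by
    obtain ⟨t, ht⟩ := exists_incident G.points[u]
    obtain ⟨i, hi, rfl⟩ := List.getElem_of_mem (mem_labels t)
    exact ⟨⟨i, hi⟩, by simpa using ht⟩

theorem isCover_iff {S : Finset (Fin G.setCover.numSets)} :
    G.setCover.IsCover S ↔ ∀ v ∈ G.points, ∃ i ∈ S,
      G.incident (G.labels[i.val]'i.isLt) v := by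
  constructor
  · intro h v hv
    obtain ⟨u, hu, rfl⟩ := List.getElem_of_mem hv
    obtain ⟨i, hi, h⟩ := h ⟨u, hu⟩
    exact ⟨i, hi, (Finset.mem_filter.1 h).2⟩
  · intro h u
    obtain ⟨i, hi, h⟩ := h (G.points[u.val]'u.isLt) (List.getElem_mem _)
    exact ⟨i, hi, Finset.mem_filter.2 ⟨Finset.mem_univ _, h⟩⟩

/-! #### Completeness -/

theorem card_filter_univ_fin {n : ℕ} (p : Fin n → Bool) :
    (Finset.univ.filter fun i => p i = true).card = ((List.finRange n).filter p).length := by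
  rw [← List.toFinset_card_of_nodup ((List.nodup_finRange n).filter p)]
  congr 1
  ext i
  simp

theorem numSat_eq (x : Fin G.numA → Fin G.alphA) (y : Fin G.numB → Fin G.alphB) :
    G.numSat x y = (Finset.univ.filter fun i : G.Edge =>
      (G.edge i).proj (x (G.edge i).src) = y (G.edge i).tgt).card := by
  have h := card_filter_univ_fin fun i : G.Edge =>
    decide ((G.edge i).proj (x (G.edge i).src) = y (G.edge i).tgt)
  simp only [decide_eq_true_eq] at h
  rw [h, numSat, ← List.countP_eq_length_filter]
  conv_lhs => rw [← List.map_getElem_finRange G.edges]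
  rw [List.countP_map]
  rfl

/-- Each edge contributes the set carrying the labels of its own ends. The bit of `u` at the label
of the `B`-end of `e` decides which of the two named edges covers the point. -/
theorem exists_cover_card_le {x : Fin G.numA → Fin G.alphA} {y : Fin G.numB → Fin G.alphB}
    (h : G.numSat x y = G.edges.length) :
    ∃ T, G.setCover.IsCover T ∧ T.card ≤ G.edges.length := by
  have hsat : ∀ i : G.Edge, (G.edge i).proj (x (G.edge i).src) = y (G.edge i).tgt := by
    rw [numSat_eq] at h
    have h' := Finset.card_eq_iff_eq_univ _ |>.1 (h.trans (Fintype.card_fin _).symm)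
    intro i
    simpa using Finset.ext_iff.1 h' i
  have hidx : ∀ i : G.Edge, ∃ k : Fin G.setCover.numSets, G.labels[k.val]'k.isLt =
      (i, x (G.edge i).src, y (G.edge i).tgt) := fun i => by
    obtain ⟨k, hk, h⟩ := List.getElem_of_mem
      (mem_labels ((i, x (G.edge i).src, y (G.edge i).tgt) : G.Label))
    exact ⟨⟨k, hk⟩, h⟩
  choose idx hidx using hidx
  refine ⟨Finset.univ.image idx, isCover_iff.2 ?_, by
    simpa using Finset.card_image_le (s := Finset.univ) (f := idx)⟩
  rintro ⟨i, e, i', u⟩ -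
  by_cases h1 : (G.edge i).src = (G.edge e).src
  swap
  · exact ⟨idx i, by simp, by simp [incident, Fin.val_inj, h1]⟩
  by_cases h2 : (G.edge i').tgt = (G.edge e).tgt
  swap
  · exact ⟨idx i, by simp, by simp [incident, Fin.val_inj, h2]⟩
  cases hu : u.getD (y (G.edge e).tgt) false with
  | false =>
    refine ⟨idx i, by simp, ?_⟩
    simp only [incident, hidx, h1, hsat, hu]
    simp
  | true =>
    refine ⟨idx i', by simp, ?_⟩
    simp only [incident, hidx, h2, hu]
    simp

/-! #### Soundness -/

/-- Every fibre of `p` has a representative of least weight. -/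
theorem exists_min_section {E V : Type} [Finite E] [Nonempty E] (p : E → V) (w : E → ℕ) :
    ∃ r : V → E, ∀ i, p (r (p i)) = p i ∧ w (r (p i)) ≤ w i := by
  have h : ∀ v, ∃ j, ∀ i, p i = v → p j = v ∧ w j ≤ w i := by
    intro v
    by_cases hv : ∃ i, p i = v
    · obtain ⟨i₀, hi₀⟩ := hv
      obtain ⟨j, hj, hmin⟩ := Set.exists_min_image {i | p i = v} w (Set.toFinite _) ⟨i₀, hi₀⟩
      exact ⟨j, fun i hi => ⟨hj, hmin i hi⟩⟩
    · exact ⟨Classical.arbitrary E, fun i hi => (hv ⟨i, hi⟩).elim⟩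
  choose r hr using h
  exact ⟨r, fun i => hr (p i) i rfl⟩

/-- If every `e` votes for a label in the list `S (p e)` of its vertex, then some labelling keeps
at least the share of the votes that a random choice from the lists would keep. -/
theorem exists_labelling {E V L : Type} [Fintype E] [Fintype V] [DecidableEq V] [DecidableEq L]
    [Nonempty L] (p : E → V) (lab : E → L) (S : V → Finset L) (hS : ∀ e, lab e ∈ S (p e))
    (w : E → ℝ) :
    ∃ x : V → L, ∑ e, w e / (S (p e)).card ≤ ∑ e with lab e = x (p e), w e := by
  have h : ∀ v, ∃ l, ∑ e with p e = v, w e / (S v).card ≤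
      ∑ e with p e = v, if lab e = l then w e else 0 := by
    intro v
    rcases (S v).eq_empty_or_nonempty with h0 | h0
    · refine ⟨Classical.arbitrary L, le_of_eq ?_⟩
      have : (Finset.univ.filter fun e => p e = v) = ∅ := by
        ext e
        simp only [Finset.mem_filter, Finset.mem_univ, true_and, Finset.notMem_empty, iff_false]
        rintro rfl
        simpa [h0] using hS e
      simp [this]
    -- Averaging: summed over `l` in the list, the kept votes give the full weight at `v`, since
    -- every vote lies in the list.
    · obtain ⟨l, -, hl⟩ := Finset.exists_le_of_sum_le h0
        (f := fun _ => ∑ e with p e = v, w e / (S v).card)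
        (g := fun l => ∑ e with p e = v, if lab e = l then w e else 0) (by
          rw [Finset.sum_const, ← Finset.sum_div, nsmul_eq_mul,
            mul_div_cancel₀ _ (by simpa using h0.ne_empty), Finset.sum_comm]
          refine Finset.sum_le_sum fun e he => ?_
          obtain rfl := (Finset.mem_filter.1 he).2
          simp [hS e])
      exact ⟨l, hl⟩
  choose x hx using h
  refine ⟨x, ?_⟩
  rw [Finset.sum_filter, ← Finset.sum_fiberwise _ p, ← Finset.sum_fiberwise Finset.univ p
    (fun e => if lab e = x (p e) then w e else 0)]
  refine Finset.sum_le_sum fun v _ => ?_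
  have e1 : ∀ f g : E → ℝ, (∀ e, p e = v → f e = g e) →
      ∑ e with p e = v, f e = ∑ e with p e = v, g e := fun f g h =>
    Finset.sum_congr rfl fun e he => h e (Finset.mem_filter.1 he).2
  exact (e1 _ _ fun e he => by simp only [he]).trans_le
    ((hx v).trans_eq (e1 _ _ fun e he => by simp only [he]))

/-- AM-GM for `a`, `b`, `1 / (a * b)`, whose product is 1. -/
theorem three_sub_le_inv_mul {a b : ℝ} (ha : 0 < a) (hb : 0 < b) : 3 - a - b ≤ 1 / (a * b) := by
  rw [le_div_iff₀ (mul_pos ha hb)]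
  nlinarith [mul_nonneg ha.le (sq_nonneg (b - 1)), mul_nonneg hb.le (sq_nonneg (a - 1)),
    mul_nonneg ha.le (sq_nonneg (a - b)), mul_nonneg hb.le (sq_nonneg (a - b)),
    mul_nonneg (add_pos ha hb).le (sq_nonneg (a + b - 2)), mul_pos ha hb, sq_nonneg (a - b),
    sq_nonneg (a * b - 1)]

/-- Hölder's inequality in the form that the soundness analysis needs. -/
theorem card_div_sq_le_sum {E : Type} [Fintype E] [Nonempty E] {a b : E → ℝ} {N : ℝ}
    (ha : ∀ e, 0 < a e) (hb : ∀ e, 0 < b e) (hN : 0 < N)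
    (haN : ∑ e, a e ≤ N * Fintype.card E) (hbN : ∑ e, b e ≤ N * Fintype.card E) :
    (Fintype.card E : ℝ) / N ^ 2 ≤ ∑ e, 1 / (a e * b e) := by
  -- After scaling by `N` each linear term sums to at most `card E`, so `3 - 1 - 1 = 1` remains per
  -- edge.
  have h : ∀ e, (3 - a e / N - b e / N) / N ^ 2 ≤ 1 / (a e * b e) := fun e => by
    refine (div_le_div_of_nonneg_right (three_sub_le_inv_mul (div_pos (ha e) hN)
      (div_pos (hb e) hN)) (by positivity)).trans_eq ?_
    have := (ha e).ne'
    have := (hb e).ne'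
    field_simp
  refine le_trans ?_ (Finset.sum_le_sum fun e _ => h e)
  rw [← Finset.sum_div]
  refine div_le_div_of_nonneg_right ?_ (by positivity)
  simp only [Finset.sum_sub_distrib, ← Finset.sum_div, Finset.sum_const, Finset.card_univ,
    nsmul_eq_mul]
  have h1 := (div_le_iff₀ hN).2 (haN.trans_eq (mul_comm _ _))
  have h2 := (div_le_iff₀ hN).2 (hbN.trans_eq (mul_comm _ _))
  linarith

/-- Lists from the cheapest edge at each vertex are no longer than the weight of any edge there, and
these weights sum to at most `|S|`. A random choice satisfies `e` with probability at least `1 /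
(|SA| |SB|)`; Hölder bounds the sum over `e`. -/
theorem exists_numSat_ge {S : Finset (Fin G.setCover.numSets)} (hS : G.setCover.IsCover S) :
    ∃ x y, (G.edges.length : ℝ) ^ 3 ≤ G.numSat x y * (S.card : ℝ) ^ 2 := by
  classical
  have hE : 0 < G.edges.length := List.length_pos_iff.2 G.edges_ne_nil
  have : Nonempty G.Edge := ⟨⟨0, hE⟩⟩
  have : Nonempty (Fin G.alphA) := ⟨⟨0, G.alphA_pos⟩⟩
  have : Nonempty (Fin G.alphB) := ⟨⟨0, G.alphB_pos⟩⟩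
  set R : Finset G.Label := S.image fun k => G.labels[k.val]'k.isLt with hR
  have hcov : ∀ v ∈ G.points, ∃ t ∈ R, G.incident t v := fun v hv => by
    obtain ⟨i, hi, h⟩ := isCover_iff.1 hS v hv
    exact ⟨_, Finset.mem_image_of_mem _ hi, h⟩
  let w : G.Edge → ℕ := fun i => (R.filter fun t => t.1 = i).card
  have hw : ∑ i, w i ≤ S.card := by
    rw [← Finset.card_eq_sum_card_fiberwise (fun t _ => Finset.mem_coe.2 (Finset.mem_univ t.1))]
    exact Finset.card_image_le
  obtain ⟨ra, hra⟩ := exists_min_section (fun i => (G.edge i).src) w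
  obtain ⟨rb, hrb⟩ := exists_min_section (fun i => (G.edge i).tgt) w
  let SA : Fin G.numA → Finset (Fin G.alphA) := fun a =>
    (R.filter fun t => t.1 = ra a).image fun t => t.2.1
  let SB : Fin G.numB → Finset (Fin G.alphB) := fun b =>
    (R.filter fun t => t.1 = rb b).image fun t => t.2.2
  have hlab : ∀ e, ∃ σ ∈ SA (G.edge e).src, (G.edge e).proj σ ∈ SB (G.edge e).tgt := by
    intro e
    -- The critical test vector: the indicator of the projected `A`-list. No set at the
    -- `A`-representative can cover it by a 0 bit, so a `B`-label must hit a projected one.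
    let P : ℕ → Bool := fun j => decide (∃ σ ∈ SA (G.edge e).src, ((G.edge e).proj σ).val = j)
    have hP : ∀ j : Fin G.alphB, ((List.range G.alphB).map P).getD j false = P j := fun j => by
      simp [List.getD]
    obtain ⟨t, ht, hinc⟩ := hcov (ra (G.edge e).src, e, rb (G.edge e).tgt, _)
      (mem_points.2 (map_range_mem_bitLists G.alphB P))
    simp only [incident, hP, (hra e).1, (hrb e).1, decide_true, Bool.and_self, Bool.not_true,
      Bool.false_or, Bool.or_eq_true, Bool.and_eq_true, Bool.not_eq_true', decide_eq_true_eq,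
      Fin.val_inj] at hinc
    rcases hinc with ⟨h1, h2⟩ | ⟨h1, h2⟩
    · refine absurd ⟨t.2.1, Finset.mem_image_of_mem _ (Finset.mem_filter.2 ⟨ht, h1⟩), rfl⟩
        (of_decide_eq_false h2)
    · obtain ⟨σ, hσ, h⟩ := of_decide_eq_true h2
      refine ⟨σ, hσ, ?_⟩
      rw [Fin.val_inj.1 h]
      exact Finset.mem_image_of_mem _ (Finset.mem_filter.2 ⟨ht, h1⟩)
  choose lab hlabA hlabB using hlab
  -- The two sides are fixed one after the other: first `x`, with the pending success probability on
  -- the `B` side as weight, then `y`, counting only edges that `x` has kept.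
  obtain ⟨x, hx⟩ := exists_labelling (fun i => (G.edge i).src) lab SA hlabA
    (fun e => 1 / ((SB (G.edge e).tgt).card : ℝ))
  obtain ⟨y, hy⟩ := exists_labelling (fun i => (G.edge i).tgt)
    (fun e => (G.edge e).proj (lab e)) SB hlabB (fun e => if lab e = x (G.edge e).src then 1 else 0)
  refine ⟨x, y, ?_⟩
  have h1 : ∑ e, (if lab e = x (G.edge e).src then (1 : ℝ) else 0) / (SB (G.edge e).tgt).card =
      ∑ e with lab e = x (G.edge e).src, 1 / ((SB (G.edge e).tgt).card : ℝ) := by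
    rw [Finset.sum_filter]
    exact Finset.sum_congr rfl fun e _ => by split_ifs <;> simp
  have h2 : (∑ e with (G.edge e).proj (lab e) = y (G.edge e).tgt,
      if lab e = x (G.edge e).src then (1 : ℝ) else 0) ≤ G.numSat x y := by
    rw [numSat_eq, ← Finset.sum_filter, Finset.filter_filter, Finset.sum_const, nsmul_eq_mul,
      mul_one, Nat.cast_le]
    refine Finset.card_le_card fun e he => ?_
    simp only [Finset.mem_filter, Finset.mem_univ, true_and] at he ⊢
    rw [← he.2, he.1]
  have hA : ∀ e, (SA (G.edge e).src).card ≤ w e := fun e =>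
    Finset.card_image_le.trans (hra e).2
  have hB : ∀ e, (SB (G.edge e).tgt).card ≤ w e := fun e =>
    Finset.card_image_le.trans (hrb e).2
  have hApos : ∀ e, 0 < (SA (G.edge e).src).card := fun e => Finset.card_pos.2 ⟨_, hlabA e⟩
  have hBpos : ∀ e, 0 < (SB (G.edge e).tgt).card := fun e => Finset.card_pos.2 ⟨_, hlabB e⟩
  have hn : 0 < S.card := lt_of_lt_of_le (Finset.sum_pos
    (fun e _ => (hApos e).trans_le (hA e)) Finset.univ_nonempty) hw
  have hE' : (0 : ℝ) < G.edges.length := by exact_mod_cast hE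
  have hn' : (0 : ℝ) < S.card := by exact_mod_cast hn
  -- The `N` of Hölder's inequality is the average number `|S| / |E|` of sets per edge.
  have hw' : ∑ i, (w i : ℝ) ≤ (S.card / G.edges.length : ℝ) * Fintype.card G.Edge := by
    rw [Fintype.card_fin, div_mul_cancel₀ _ hE'.ne']
    exact_mod_cast hw
  have h3 := card_div_sq_le_sum (E := G.Edge) (a := fun e => ((SA (G.edge e).src).card : ℝ))
    (b := fun e => ((SB (G.edge e).tgt).card : ℝ)) (N := S.card / G.edges.length)
    (fun e => by exact_mod_cast hApos e) (fun e => by exact_mod_cast hBpos e) (div_pos hn' hE')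
    ((Finset.sum_le_sum fun e _ => by exact_mod_cast hA e).trans hw')
    ((Finset.sum_le_sum fun e _ => by exact_mod_cast hB e).trans hw')
  have h4 : ∑ e, 1 / (((SA (G.edge e).src).card : ℝ) * (SB (G.edge e).tgt).card) =
      ∑ e, 1 / ((SB (G.edge e).tgt).card : ℝ) / (SA (G.edge e).src).card :=
    Finset.sum_congr rfl fun e _ => by rw [div_div, mul_comm]
  have h5 := h3.trans (h4.trans_le (hx.trans (h1.symm.trans_le (hy.trans h2))))
  rw [Fintype.card_fin] at h5
  have h6 : (G.edges.length : ℝ) / (S.card / G.edges.length) ^ 2 =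
      (G.edges.length : ℝ) ^ 3 / (S.card : ℝ) ^ 2 := by
    field_simp
  rw [h6, div_le_iff₀ (by positivity)] at h5
  exact h5

end ProjectionGame
-- Computability of the reduction
namespace PolyTimeIn

variable {α : Type} {s : α → ℕ} {inp : α → Data}

theorem finRange {n : α → ℕ} (hn : PolyTimeIn s inp (fun a => encNat (n a)))
    (hin : PolyTimeIn s inp inp) :
    PolyTimeIn s inp (fun a => encList ((List.finRange (n a)).map fun i => encNat i.val)) :=
  (range hn hin).congr fun a => by
    rw [← List.map_coe_finRange_eq_range, List.map_map]; rfl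

end PolyTimeIn

open PolyTimeIn

def GameEdge.enc {a b c d : ℕ} (e : GameEdge a b c d) : Data :=
  encList [encNat e.src, encNat e.tgt, encList (List.ofFn fun s => encNat (e.proj s))]

namespace ProjectionGame

variable {α : Type} {s : α → ℕ} {inp : α → Data} {G : α → ProjectionGame}

theorem polyTimeIn_edges (hG : PolyTimeIn s inp fun a => (G a).enc) :
    PolyTimeIn s inp (fun a => encList ((G a).edges.map GameEdge.enc)) :=
  hG.snd.snd.snd.snd.fst

theorem polyTimeIn_alphA (hG : PolyTimeIn s inp fun a => (G a).enc) :
    PolyTimeIn s inp (fun a => encNat (G a).alphA) :=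
  hG.snd.snd.fst

theorem polyTimeIn_alphB (hG : PolyTimeIn s inp fun a => (G a).enc) :
    PolyTimeIn s inp (fun a => encNat (G a).alphB) :=
  hG.snd.snd.snd.fst

/-- Index and contents are stored together, so that incidence is decided from point and label alone.
-/
def encEdge (G : ProjectionGame) (i : G.Edge) : Data := .node (encNat i) (G.edge i).enc

def encPoint (G : ProjectionGame) (v : G.Point) : Data :=
  .node (G.encEdge v.1) (.node (G.encEdge v.2.1) (.node (G.encEdge v.2.2.1) (encBits v.2.2.2)))

def encLabel (G : ProjectionGame) (t : G.Label) : Data :=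
  .node (encNat t.1) (.node (encNat t.2.1) (encNat t.2.2))

theorem polyTimeIn_edgeList (hG : PolyTimeIn s inp fun a => (G a).enc)
    (hin : PolyTimeIn s inp inp) :
    PolyTimeIn s inp (fun a => encList ((List.finRange (G a).edges.length).map (G a).encEdge)) := by
  have hE := polyTimeIn_edges hG
  refine map (finRange (hE.length hin) hin) hin fun h => h.fst.node ?_
  refine getElem (hE.lift h.snd) h.fst fun q => ?_
  simp [edge]

theorem polyTimeIn_points (hG : PolyTimeIn s inp fun a => (G a).enc)
    (hin : PolyTimeIn s inp inp) (hexp : PolyBounded s fun a => 2 ^ (G a).alphB) :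
    PolyTimeIn s inp (fun a => encList ((G a).points.map (G a).encPoint)) := by
  have hE := polyTimeIn_edgeList hG hin
  exact product hE (product hE (product hE ((polyTimeIn_alphB hG).bitLists hexp) hin) hin) hin

theorem polyTimeIn_labels (hG : PolyTimeIn s inp fun a => (G a).enc)
    (hin : PolyTimeIn s inp inp) :
    PolyTimeIn s inp (fun a => encList ((G a).labels.map (G a).encLabel)) :=
  product (finRange ((polyTimeIn_edges hG).length hin) hin)
    (product (finRange (polyTimeIn_alphA hG) hin) (finRange (polyTimeIn_alphB hG) hin) hin) hin

/-- Membership in `points` gives `u` the full length `alphB`, so every bit lookup is in range. -/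
theorem polyTimeIn_incident {t : ∀ a, (G a).Label} {v : ∀ a, (G a).Point}
    (ht : PolyTimeIn s inp fun a => (G a).encLabel (t a))
    (hv : PolyTimeIn s inp fun a => (G a).encPoint (v a))
    (hmem : ∀ a, v a ∈ (G a).points) :
    PolyTimeIn s inp fun a => encBool ((G a).incident (t a) (v a)) := by
  have hlen : ∀ a, (v a).2.2.2.length = (G a).alphB := fun a =>
    length_of_mem_bitLists (mem_points.1 (hmem a))
  have hi := hv.fst
  have he := hv.snd.fst.snd
  have hi' := hv.snd.snd.fst
  have hu : PolyTimeIn s inp fun a => encList ((v a).2.2.2.map encBool) := hv.snd.snd.snd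
  have hbit : ∀ j : ∀ a, Fin (G a).alphB, PolyTimeIn s inp (fun a => encNat (j a)) →
      PolyTimeIn s inp fun a => encBool ((v a).2.2.2.getD (j a) false) := fun j hj =>
    getElem hu hj fun a => by simp [hlen]
  have hproj : PolyTimeIn s inp fun a => encNat (((G a).edge (v a).2.1).proj (t a).2.1) :=
    getElem (l := fun a => List.ofFn fun σ => encNat (((G a).edge (v a).2.1).proj σ))
      he.snd.snd.fst (N := fun a => (t a).2.1) ht.snd.fst fun a => by simp
  exact (((natEq hi.snd.fst he.fst).and (natEq hi'.snd.snd.fst he.snd.fst)).not).or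
    (((natEq ht.fst hi.fst).and (hbit _ hproj).not).or
      ((natEq ht.fst hi'.fst).and (hbit _ ht.snd.snd)))

theorem ofFn_getElem {β γ : Type} (l : List β) (f : β → γ) :
    List.ofFn (fun i : Fin l.length => f l[i]) = l.map f := by
  rw [List.ofFn_eq_map]
  conv_rhs => rw [← List.map_getElem_finRange l]
  rw [List.map_map]; rfl

theorem enc_setCover (G : ProjectionGame) : G.setCover.enc =
    .node (encNat G.points.length) (encList (G.labels.map fun t =>
      encList (G.points.map fun v => encBool (G.incident t v)))) := by
  rw [← ofFn_getElem G.labels]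
  simp only [← ofFn_getElem G.points]
  unfold SetCover.enc
  congr 3
  funext i
  congr 2
  funext u
  congr 1
  rw [Bool.eq_iff_iff, decide_eq_true_iff]
  exact Finset.mem_filter.trans (and_iff_right (Finset.mem_univ _))

theorem polyTimeIn_row {t : ∀ a, (G a).Label}
    (ht : PolyTimeIn s inp fun a => (G a).encLabel (t a)) (hin : PolyTimeIn s inp inp)
    (hP : PolyTimeIn s inp (fun a => encList ((G a).points.map (G a).encPoint))) :
    PolyTimeIn s inp fun a => encList ((G a).points.map fun v =>
      encBool ((G a).incident (t a) v)) :=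
  map hP hin fun h =>
    polyTimeIn_incident (G := fun q : {q : Σ a, (G a).Point // q.2 ∈ (G q.1).points} => G q.1.1)
      (t := fun q => t q.1.1) (v := fun q => q.1.2) (ht.lift h.snd) h.fst fun q => q.2

theorem polyTimeIn_setCover (hG : PolyTimeIn s inp fun a => (G a).enc)
    (hin : PolyTimeIn s inp inp) (hexp : PolyBounded s fun a => 2 ^ (G a).alphB) :
    PolyTimeIn s inp (fun a => (G a).setCover.enc) := by
  simp only [enc_setCover]
  have hP := polyTimeIn_points hG hin hexp
  exact (hP.length hin).node (map (polyTimeIn_labels hG hin) hin fun h =>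
    polyTimeIn_row (G := fun q : {q : Σ a, (G a).Label // q.2 ∈ (G q.1).labels} => G q.1.1)
      (t := fun q => q.1.2) h.fst h (hP.lift h.snd))

end ProjectionGame

/-! ### Counting the sets of a solution -/

theorem PolyTimeIn.card_of_encSol {α : Type} {s : α → ℕ} {inp : α → Data} {I : α → SetCover}
    {S : ∀ a, Finset (Fin (I a).numSets)} (hS : PolyTimeIn s inp fun a => (I a).encSol (S a))
    (hin : PolyTimeIn s inp inp) : PolyTimeIn s inp fun a => encNat (S a).card := by
  have h1 : PolyTimeIn s inp fun a => encList ((List.finRange (I a).numSets).map fun i =>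
      encBool (decide (i ∈ S a))) := hS.congr fun a => by rw [SetCover.encSol, List.ofFn_eq_map]
  refine ((filter (b := fun a i => decide (i ∈ S a)) h1 hin fun h => h.fst).length hin).congr
    fun a => ?_
  rw [← ProjectionGame.card_filter_univ_fin]
  simp

/-! ### Integer roots -/

/-- The largest `j ≥ 1` with `j ^ r ≤ max 1 n`. -/
def root (r n : ℕ) : ℕ := ((List.range n).filter fun i => decide ((i + 2) ^ r ≤ n)).length + 1

theorem PolyTimeIn.root {α : Type} {s : α → ℕ} {inp : α → Data} {n : α → ℕ} (r : ℕ)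
    (hn : PolyTimeIn s inp fun a => encNat (n a)) (hin : PolyTimeIn s inp inp) :
    PolyTimeIn s inp fun a => encNat (root r (n a)) :=
  ((filter (b := fun a i => decide ((i + 2) ^ r ≤ n a)) (range hn hin) hin fun h =>
    natLE (h.fst.natSucc.natSucc.natPow h r) (hn.lift h.snd)).length hin).natSucc

theorem one_le_root (r n : ℕ) : 1 ≤ root r n := Nat.le_add_left _ _

theorem root_spec {r : ℕ} (hr : r ≠ 0) (n : ℕ) :
    root r n ^ r ≤ max 1 n ∧ n < (root r n + 1) ^ r := by
  -- The tested condition is antitone in `i`, so filtering leaves an initial segment; `j` is where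
  -- it stops.
  have hanti : ∀ m, ∃ j ≤ m, ((List.range m).filter fun i => decide ((i + 2) ^ r ≤ n)) =
      List.range j ∧ (j ≠ 0 → (j + 1) ^ r ≤ n) ∧ (j < m → n < (j + 2) ^ r) := by
    intro m
    induction m with
    | zero => exact ⟨0, le_rfl, by simp⟩
    | succ m ih =>
      obtain ⟨j, hj, h1, h2, h3⟩ := ih
      rw [List.range_succ, List.filter_append, h1]
      by_cases h : (m + 2) ^ r ≤ n
      · obtain rfl : j = m := by
          by_contra hne
          have h4 := h3 (by omega)
          have h5 : (j + 2) ^ r ≤ (m + 2) ^ r := Nat.pow_le_pow_left (by omega) r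
          omega
        exact ⟨j + 1, le_rfl, by simp [h, List.range_succ], fun _ => h, by simp⟩
      · refine ⟨j, by omega, by simp [h], h2, fun _ => ?_⟩
        rcases hj.lt_or_eq with h4 | rfl
        · exact h3 h4
        · omega
  obtain ⟨j, hj, h1, h2, h3⟩ := hanti n
  have hroot : SetCoverHardness.root r n = j + 1 := by
    rw [SetCoverHardness.root, h1, List.length_range]
  rw [hroot]
  constructor
  · rcases Nat.eq_zero_or_pos j with rfl | h
    · simp
    · exact (h2 (by omega)).trans (le_max_right _ _)
  · rcases hj.lt_or_eq with h4 | rfl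
    · exact h3 h4
    · exact lt_of_lt_of_le (by omega) (Nat.le_self_pow hr (j + 2))

/-! ### Formulas as inputs -/

theorem encNat_injective : Function.Injective encNat := fun m n h => by
  have := congrArg Data.size h
  simp only [size_encNat] at this
  omega

theorem encBool_injective : Function.Injective encBool := fun b c h => by
  cases b <;> cases c <;> simp_all [encBool]

theorem encList_injective : Function.Injective encList := by
  intro l
  induction l with
  | nil => intro l' h; cases l' <;> simp_all [encList]
  | cons x l ih =>
    intro l' h
    cases l' with
    | nil => simp [encList] at h
    | cons y l' =>
      simp only [encList, Data.node.injEq] at h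
      rw [h.1, ih h.2]

theorem CNF3.enc_injective : Function.Injective CNF3.enc := by
  rintro ⟨n, l⟩ ⟨n', l'⟩ h
  simp only [CNF3.enc, Data.node.injEq] at h
  obtain rfl := encNat_injective h.1
  congr 1
  refine List.map_injective_iff.2 (fun C C' hC => ?_) (encList_injective h.2)
  have := List.ofFn_injective (encList_injective hC)
  funext j
  have hj := congrFun this j
  simp only [Data.node.injEq] at hj
  exact Prod.ext (Fin.ext (encNat_injective hj.1)) (encBool_injective hj.2)

/-- The asymptotic estimates fail only for small formulas; being finitely many, these can be
hard-wired. -/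
theorem CNF3.finite_size_lt (N : ℕ) : {φ : CNF3 | φ.size < N}.Finite := by
  refine ((Set.finite_lt_nat N).biUnion fun n _ =>
    (List.finite_length_lt (Fin 3 → Fin n × Bool) N).image (CNF3.mk n)).subset fun φ hφ => ?_
  simp only [Set.mem_ofPred_eq, CNF3.size] at hφ
  simp only [Set.mem_iUnion]
  exact ⟨φ.numVars, show _ < N by omega, φ.clauses, show _ < N by omega, rfl⟩

theorem CNF3.size_enc_le (φ : CNF3) :
    φ.enc.size ≤ (2 * φ.size + 1) + (φ.size * (3 * (2 * φ.size + 6) + 2) + 1) + 1 := by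
  have hv : φ.numVars ≤ φ.size := Nat.le_add_right _ _
  have hc : φ.clauses.length ≤ φ.size := Nat.le_add_left _ _
  have h : ∀ x ∈ φ.clauses.map (fun C => encList (List.ofFn fun j =>
      Data.node (encNat (C j).1) (encBool (C j).2))), x.size ≤ 3 * (2 * φ.size + 6) + 1 := by
    intro x hx
    obtain ⟨C, -, rfl⟩ := List.mem_map.1 hx
    refine (size_encList_le (b := 2 * φ.size + 5) fun y hy => ?_).trans (by simp)
    obtain ⟨j, rfl⟩ := (List.mem_ofFn' _ _).1 hy
    have h1 := (C j).1.isLt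
    have h2 : (encBool (C j).2).size ≤ 3 := by cases (C j).2 <;> simp [encBool, Data.size]
    simp only [Data.size, size_encNat]
    omega
  have h1 := size_encList_le h
  rw [List.length_map] at h1
  have h2 : φ.clauses.length * (3 * (2 * φ.size + 6) + 1 + 1) ≤
      φ.size * (3 * (2 * φ.size + 6) + 2) := Nat.mul_le_mul_right _ hc
  simp only [CNF3.enc, Data.size, size_encNat]
  omega

theorem CNF3.polyBounded_size_enc : PolyBounded CNF3.size (fun φ => φ.enc.size) :=
  PolyBounded.of_le
    (((((PolyBounded.const 2).mul .refl).add (.const 1)).add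
      ((PolyBounded.refl.mul (((PolyBounded.const 3).mul
        (((PolyBounded.const 2).mul .refl).add (.const 6))).add (.const 2))).add (.const 1))).add
      (.const 1)) CNF3.size_enc_le

theorem CNF3.polyTimeIn_size {s : CNF3 → ℕ} (h : PolyTimeIn s CNF3.enc CNF3.enc) :
    PolyTimeIn s CNF3.enc (fun φ => encNat φ.size) :=
  natAdd h.fst (length (l := CNF3.clauses) h.snd h) h

/-- Finitely many answers of a decision procedure can be corrected. -/
theorem PolyTimeIn.correct_finite {α : Type} {s : α → ℕ} {inp : α → Data}
    (hinj : Function.Injective inp) (hin : PolyTimeIn s inp inp) {F : Set α} (hF : F.Finite)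
    {b b' : α → Bool} (hb : PolyTimeIn s inp fun a => encBool (b a)) (h : ∀ a ∉ F, b a = b' a) :
    PolyTimeIn s inp fun a => encBool (b' a) := by
  classical
  induction F, hF using Set.Finite.induction_on generalizing b with
  | empty => exact hb.congr fun a => by rw [h a (Set.notMem_empty a)]
  | @insert a₀ F _ _ ih =>
    have hc : PolyTimeIn s inp fun _ => encBool (b' a₀) := by
      cases b' a₀
      · exact encBool_false
      · exact encBool_true
    -- One exception at a time: the input is compared with the fixed tree encoding `a₀`, which
    -- injectivity makes decisive.
    have heq : PolyTimeIn s inp fun a => encBool (decide (a = a₀)) :=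
      eq_const hin (inp a₀) fun a => by rw [decide_eq_true_iff, hinj.eq_iff]
    refine ih (b := fun a => if a = a₀ then b' a₀ else b a)
      ((heq.cond hc hb).congr fun a => ?_) fun a ha => ?_
    · by_cases h0 : a = a₀ <;> simp [h0]
    · by_cases h0 : a = a₀
      · simp [h0]
      · simpa [h0] using h a (by simp [h0, ha])

/-! ### Time `2 ^ O(√n)` -/

/-- The value at 1 is the sum of the coefficients, and each power of `x ≥ 1` is at most the top one.
-/
theorem eval_le_eval_one_mul_pow (p : Polynomial ℕ) {x : ℕ} (hx : 1 ≤ x) :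
    p.eval x ≤ p.eval 1 * x ^ p.natDegree := by
  rw [Polynomial.eval_eq_sum_range, Polynomial.eval_eq_sum_range, Finset.sum_mul]
  refine Finset.sum_le_sum fun i hi => ?_
  rw [one_pow, mul_one]
  exact Nat.mul_le_mul_left _ (Nat.pow_le_pow_right hx (by simpa [Nat.lt_succ_iff] using hi))

theorem isLittleO_natSqrt :
    (fun n : ℕ => (n.sqrt : ℝ)) =o[atTop] (fun n : ℕ => (n : ℝ)) := by
  refine Asymptotics.IsLittleO.of_bound fun c hc => ?_
  obtain ⟨N, hN⟩ := exists_nat_gt (1 / c)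
  filter_upwards [eventually_ge_atTop (N * N)] with n hn
  have h1 : (N : ℝ) ≤ n.sqrt := by exact_mod_cast Nat.le_sqrt.2 hn
  have h2 : (n.sqrt : ℝ) * n.sqrt ≤ n := by exact_mod_cast Nat.sqrt_le n
  rw [Real.norm_natCast, Real.norm_natCast]
  have h3 : 1 ≤ c * n.sqrt := by
    have := (div_lt_iff₀ hc).1 (hN.trans_le h1)
    linarith
  nlinarith [Nat.cast_nonneg (α := ℝ) n.sqrt, mul_le_mul_of_nonneg_left h2 hc.le,
    mul_le_mul_of_nonneg_right h3 (Nat.cast_nonneg (α := ℝ) n.sqrt)]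

open Classical in
-- A polynomial in `2 ^ √n` is at most `2 ^ (p(1) + deg p · √n)`, whose exponent is `o(n)`.
theorem not_ETH_of_polyTimeIn
    (h : PolyTimeIn (fun φ : CNF3 => 2 ^ φ.size.sqrt) CNF3.enc
      (fun φ => encBool (decide φ.Satisfiable))) : ¬ ETH := by
  obtain ⟨M, T, ⟨p, hp⟩, hM⟩ := h
  refine fun hETH => hETH ⟨M, fun n => (p.eval 1 : ℕ) + (p.natDegree : ℝ) * n.sqrt, ?_,
    fun φ => ⟨T φ, ?_, hM φ⟩⟩
  · refine Asymptotics.IsLittleO.add ?_ (isLittleO_natSqrt.const_mul_left _)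
    exact Asymptotics.isLittleO_const_left.2 (.inr
      (tendsto_norm_atTop_atTop.comp tendsto_natCast_atTop_atTop))
  · have h1 := (hp φ).trans (eval_le_eval_one_mul_pow p Nat.one_le_two_pow)
    have h2 : T φ ≤ 2 ^ (p.eval 1 + p.natDegree * φ.size.sqrt) := by
      rw [pow_add, mul_comm p.natDegree, pow_mul]
      exact h1.trans (Nat.mul_le_mul_right _ Nat.lt_two_pow_self.le)
    have h3 : ((p.eval 1 : ℕ) : ℝ) + (p.natDegree : ℝ) * φ.size.sqrt =
        ((p.eval 1 + p.natDegree * φ.size.sqrt : ℕ) : ℝ) := by push_cast; ring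
    change (T φ : ℝ) ≤ 2 ^ (((p.eval 1 : ℕ) : ℝ) + (p.natDegree : ℝ) * φ.size.sqrt)
    rw [h3, Real.rpow_natCast]
    exact_mod_cast h2

/-- Makes everything polynomial in `n` affordable in the measure `2 ^ √n`. -/
theorem polyBounded_two_pow_sqrt : PolyBounded (fun n : ℕ => 2 ^ n.sqrt) (fun n => n) :=
  PolyBounded.of_le (PolyBounded.pow (PolyBounded.refl.add (.const 1)) 2) fun n =>
    (Nat.lt_succ_sqrt' n).le.trans (Nat.pow_le_pow_left
      (Nat.succ_le_succ Nat.lt_two_pow_self.le) 2)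

/-! ### Parameters of the reduction -/

theorem polyTime_root_sq (r : ℕ) : PolyTime encNat (fun n => encNat (root r n ^ 2)) := by
  have hin : PolyTimeIn (fun n => (encNat n).size) encNat encNat := ident .refl
  exact ((PolyTimeIn.root r (n := fun n => n) hin hin).natPow hin 2).polyTime

/-- Admissibility of `k = J²` in the conjecture: `J ^ r ≤ n` gives `J² ≤ n ^ (2/r)`, and `2/r ≤ c`.
-/
theorem root_sq_le {r : ℕ} {c : ℝ} (hr : r ≠ 0) (hc : 2 / c ≤ r) (hc0 : 0 < c) (n : ℕ) :
    ((root r n ^ 2 : ℕ) : ℝ) ≤ max 1 ((n : ℝ) ^ c) := by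
  have h := (root_spec hr n).1
  rcases Nat.eq_zero_or_pos n with rfl | hn
  · have : root r 0 = 1 := by
      refine le_antisymm ?_ (one_le_root _ _)
      exact (Nat.le_self_pow hr _).trans (by simpa using h)
    simp [this]
  · refine le_trans ?_ (le_max_right _ _)
    rw [max_eq_right hn] at h
    have hr' : (0 : ℝ) < r := by positivity
    have h1 : ((root r n ^ 2 : ℕ) : ℝ) = ((root r n : ℝ) ^ r) ^ (2 / r : ℝ) := by
      rw [← Real.rpow_natCast, ← Real.rpow_mul (by positivity), mul_div_cancel₀ _ hr'.ne']
      norm_cast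
    have h2 : (root r n : ℝ) ^ r ≤ n := by exact_mod_cast h
    rw [h1]
    refine (Real.rpow_le_rpow (by positivity) h2 (by positivity)).trans
      (Real.rpow_le_rpow_of_exponent_le (by exact_mod_cast hn) ?_)
    rw [div_le_iff₀ hr']
    rwa [div_le_iff₀ hc0, mul_comm] at hc

/-- Since `J ^ (4C) ≤ J ^ r ≤ max 1 n`, the alphabets have size `O(√n)`, which keeps `2 ^ |Σ_B|`
subexponential. -/
theorem root_pow_le_sqrt {r C : ℕ} (hr : r ≠ 0) (hC : 4 * C ≤ r) (n : ℕ) :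
    (root r n ^ 2) ^ C ≤ n.sqrt + 1 := by
  have h1 : ((root r n ^ 2) ^ C) ^ 2 ≤ max 1 n := by
    rw [← pow_mul, ← pow_mul]
    exact (Nat.pow_le_pow_right (one_le_root r n) (by omega)).trans (root_spec hr n).1
  by_contra! h
  have h2 : (n.sqrt + 1) ^ 2 < ((root r n ^ 2) ^ C) ^ 2 := Nat.pow_lt_pow_left h (by norm_num)
  have h3 : n < (n.sqrt + 1) ^ 2 := Nat.lt_succ_sqrt' n
  have h4 : 1 ≤ (n.sqrt + 1) ^ 2 := Nat.one_le_pow _ _ (by omega)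
  omega

theorem two_le_root {r n : ℕ} (hr : r ≠ 0) (hn : 2 ^ r ≤ n) : 2 ≤ root r n := by
  by_contra! h
  have h1 : root r n = 1 := le_antisymm (by omega) (one_le_root r n)
  have h2 := (root_spec hr n).2
  rw [h1, one_add_one_eq_two] at h2
  omega

/-- The exponent `d / (d + 1)` is below 1 and `J > 1`, so the approximation ratio is strictly below
the gap. -/
theorem natCast_rpow_lt {m J d : ℕ} (hJ : 2 ≤ J) (hm : m ≤ J ^ d) :
    (m : ℝ) ^ (1 / (d + 1) : ℝ) < J := by
  have hJ' : (1 : ℝ) < J := by exact_mod_cast hJ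
  have h1 : (m : ℝ) ≤ (J : ℝ) ^ d := by exact_mod_cast hm
  refine (Real.rpow_le_rpow (by positivity) h1 (by positivity)).trans_lt ?_
  rw [← Real.rpow_natCast, ← Real.rpow_mul (by positivity)]
  conv_rhs => rw [← Real.rpow_one (J : ℝ)]
  refine Real.rpow_lt_rpow_of_exponent_lt hJ' ?_
  rw [mul_one_div, div_lt_one (by positivity)]
  linarith

theorem length_labels (G : ProjectionGame) :
    G.setCover.numSets = G.edges.length * (G.alphA * G.alphB) := by
  change (G.labels).length = _
  rw [ProjectionGame.labels, List.length_product, List.length_product]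
  simp

/-- The number of sets is polynomial in the `r`-th root of the size of the formula. -/
theorem numSets_le {G : ProjectionGame} {n r C : ℕ} {δ : ℝ} (hr : r ≠ 0) (hδ : δ ≤ 1)
    (hJ : 2 ≤ root r n)
    (hsize : (G.size : ℝ) ≤ C * ((n : ℝ) + 1) ^ (1 + δ) * ((root r n ^ 2 : ℕ) : ℝ) ^ C)
    (hA : G.alphA ≤ C * (root r n ^ 2) ^ C) (hB : G.alphB ≤ C * (root r n ^ 2) ^ C) :
    G.setCover.numSets ≤ root r n ^ (9 * C + 4 * r) := by
  have hn := (root_spec hr n).2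
  set J := root r n
  have hC : C ≤ J ^ C := (Nat.lt_two_pow_self.le).trans (Nat.pow_le_pow_left hJ C)
  have hCJ : C * (J ^ 2) ^ C ≤ J ^ (3 * C) := by
    refine (Nat.mul_le_mul_right _ hC).trans_eq ?_
    rw [← pow_mul, ← pow_add]
    congr 1
    omega
  -- From `n < (J + 1) ^ r` and `J + 1 ≤ J²`, valid as `J ≥ 2`.
  have hn' : (n + 1) ^ 2 ≤ J ^ (4 * r) := by
    have h1 : n + 1 ≤ (J ^ 2) ^ r := by
      refine hn.trans_le' le_rfl |>.trans_le ?_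
      exact Nat.pow_le_pow_left (by nlinarith) r
    refine (Nat.pow_le_pow_left h1 2).trans_eq ?_
    rw [← pow_mul, ← pow_mul]
    congr 1
    omega
  have hE : G.edges.length ≤ C * (n + 1) ^ 2 * (J ^ 2) ^ C := by
    have h1 : (G.edges.length : ℝ) ≤ G.size := by
      exact_mod_cast Nat.le_add_left _ _
    have h2 : ((n : ℝ) + 1) ^ (1 + δ) ≤ ((n : ℝ) + 1) ^ 2 := by
      rw [← Real.rpow_natCast]
      refine Real.rpow_le_rpow_of_exponent_le (by linarith [Nat.cast_nonneg (α := ℝ) n]) ?_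
      push_cast
      linarith
    have h3 := h1.trans (hsize.trans (mul_le_mul_of_nonneg_right
      (mul_le_mul_of_nonneg_left h2 (Nat.cast_nonneg C)) (by positivity)))
    exact_mod_cast h3
  rw [length_labels]
  -- The factor `(n + 1)²` costs `4r`; each of the three factors `C · J ^ (2C)` costs `3C`.
  calc G.edges.length * (G.alphA * G.alphB)
      ≤ (C * (n + 1) ^ 2 * (J ^ 2) ^ C) * (J ^ (3 * C) * J ^ (3 * C)) := by
        gcongr
        · exact hA.trans hCJ
        · exact hB.trans hCJ
    _ = (n + 1) ^ 2 * (C * (J ^ 2) ^ C) * (J ^ (3 * C) * J ^ (3 * C)) := by ring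
    _ ≤ J ^ (4 * r) * J ^ (3 * C) * (J ^ (3 * C) * J ^ (3 * C)) := by gcongr
    _ = J ^ (9 * C + 4 * r) := by
        rw [← pow_add, ← pow_add, ← pow_add]
        congr 1
        omega

/-- A good cover distinguishes satisfiable from far from satisfiable games. -/
theorem card_lt_iff {G : ProjectionGame} {J : ℕ} {ρ : ℝ} (hJ : 1 ≤ J) (hρ : ρ < J) (hρ0 : 0 ≤ ρ)
    {S : Finset (Fin G.setCover.numSets)} (hS : G.setCover.IsCover S)
    (happ : ∀ T, G.setCover.IsCover T → (S.card : ℝ) ≤ ρ * T.card) {P : Prop}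
    (hyes : P → ∃ x y, G.numSat x y = G.edges.length)
    (hno : ¬ P → ∀ x y, (G.numSat x y : ℝ) ≤ (1 / ((J ^ 2 : ℕ) : ℝ)) * G.edges.length) :
    S.card + 1 ≤ G.edges.length * J ↔ P := by
  have hE : (0 : ℝ) < G.edges.length := by
    exact_mod_cast List.length_pos_iff.2 G.edges_ne_nil
  constructor
  · intro h
    by_contra hP
    obtain ⟨x, y, hxy⟩ := ProjectionGame.exists_numSat_ge hS
    have hJ' : (0 : ℝ) < (J : ℝ) ^ 2 := by positivity
    have h1 := hxy.trans (mul_le_mul_of_nonneg_right (hno hP x y) (sq_nonneg _))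
    push_cast at h1
    -- Soundness turns `|E|³ ≤ numSat · |S|²` into `|E| · J ≤ |S|`, contradicting the strict
    -- threshold.
    have h2 : ((G.edges.length : ℝ) * J) ^ 2 ≤ (S.card : ℝ) ^ 2 := by
      rw [one_div, mul_assoc, ← div_eq_inv_mul, le_div_iff₀ hJ'] at h1
      refine le_of_mul_le_mul_left ?_ hE
      calc _ = (G.edges.length : ℝ) ^ 3 * (J : ℝ) ^ 2 := by ring
        _ ≤ _ := h1
    have h3 := le_of_sq_le_sq h2 (Nat.cast_nonneg _)
    have h4 : G.edges.length * J ≤ S.card := by exact_mod_cast h3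
    omega
  · intro hP
    obtain ⟨x, y, hxy⟩ := hyes hP
    obtain ⟨T, hT, hTc⟩ := ProjectionGame.exists_cover_card_le hxy
    have h1 : (T.card : ℝ) ≤ G.edges.length := by exact_mod_cast hTc
    have h2 : (S.card : ℝ) < G.edges.length * J := calc
      (S.card : ℝ) ≤ ρ * T.card := happ T hT
      _ ≤ ρ * G.edges.length := mul_le_mul_of_nonneg_left h1 hρ0
      _ < J * G.edges.length := mul_lt_mul_of_pos_right hρ hE
      _ = _ := mul_comm _ _
    exact_mod_cast h2

/-! ### Assembling the subexponential algorithm for 3-SAT -/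

theorem not_hasPolyTimeApprox (hETH : ETH) (hPGC : ProjectionGamesConjecture) :
    ∃ c : ℝ, 0 < c ∧ ¬ HasPolyTimeApprox (fun m : ℕ => (m : ℝ) ^ c) := by
  classical
  obtain ⟨c₀, hc₀, C, hPGC⟩ := hPGC
  obtain ⟨r₀, hr₀⟩ := exists_nat_ge (2 / c₀)
  -- `4 * C ≤ r` keeps the alphabets near `√n`; `2 / c₀ ≤ r` makes the error admissible.
  obtain ⟨r, hr, hrC, hrc⟩ : ∃ r : ℕ, r ≠ 0 ∧ 4 * C ≤ r ∧ 2 / c₀ ≤ r :=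
    ⟨r₀ + 4 * C + 1, by omega, by omega, hr₀.trans (by exact_mod_cast (by omega))⟩
  obtain ⟨red, hred, o, ho, hspec⟩ := hPGC (fun n => root r n ^ 2) (polyTime_root_sq r) fun n =>
    ⟨Nat.one_le_pow _ _ (one_le_root r n), root_sq_le hr hrc hc₀ n⟩
  obtain ⟨n₁, hn₁⟩ := eventually_atTop.1 (ho.eventually_le_const zero_lt_one)
  set d := 9 * C + 4 * r
  refine ⟨1 / ((d : ℝ) + 1), by positivity, ?_⟩
  rintro ⟨sol, hsol, happ⟩
  let s : CNF3 → ℕ := fun φ => 2 ^ φ.size.sqrt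
  have hs : PolyBounded s CNF3.size := polyBounded_two_pow_sqrt.reindex CNF3.size
  have henc : PolyBounded s (fun φ => φ.enc.size) := hs.trans CNF3.polyBounded_size_enc
  have hin : PolyTimeIn s CNF3.enc CNF3.enc := ident henc
  have hG : PolyTimeIn s CNF3.enc (fun φ => (red φ).enc) := hred.polyTimeIn.of_measure henc
  have hexp : PolyBounded s (fun φ => 2 ^ (red φ).alphB) := by
    refine PolyBounded.of_le ((PolyBounded.const (2 ^ C)).mul (PolyBounded.refl.pow C)) fun φ => ?_
    rw [← pow_mul, ← pow_add]
    refine Nat.pow_le_pow_right (by norm_num) ((hspec φ).2.2.1.trans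
      ((Nat.mul_le_mul_left C (root_pow_le_sqrt hr hrC φ.size)).trans_eq (by ring)))
  have hI := ProjectionGame.polyTimeIn_setCover hG hin hexp
  have hS := hI.comp ((hsol.polyTimeIn.reindex fun φ => (red φ).setCover).of_measure hI.polyBounded)
  have hE := (ProjectionGame.polyTimeIn_edges hG).length hin
  -- The decision procedure: accept if the computed cover has fewer than `|E| · J` sets.
  have hb := natLE (hS.card_of_encSol hin).natSucc
    (hE.natMul ((CNF3.polyTimeIn_size hin).root r hin) hin)
  -- From size `n₁` on the `o(1)` in the exponent is at most 1, and from `2 ^ r` on `J ≥ 2`; smaller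
  -- formulas are corrected by hand.
  refine not_ETH_of_polyTimeIn (correct_finite CNF3.enc_injective hin
    (CNF3.finite_size_lt (max n₁ (2 ^ r))) hb fun φ hφ => ?_) hETH
  have hφ' : max n₁ (2 ^ r) ≤ φ.size := not_lt.1 hφ
  have hJ := two_le_root hr ((le_max_right _ _).trans hφ')
  obtain ⟨h1, h2, h3, h4, h5⟩ := hspec φ
  have hm := numSets_le hr (hn₁ φ.size ((le_max_left _ _).trans hφ')) hJ h1 h2 h3
  rw [decide_eq_decide]
  exact card_lt_iff (by omega) (natCast_rpow_lt hJ hm) (by positivity)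
    (happ (red φ).setCover).1 (happ (red φ).setCover).2 h4 h5

end SetCoverHardness

theorem mainTheorem9 (hETH : SetCoverHardness.ETH)
    (hPGC : SetCoverHardness.ProjectionGamesConjecture) :
    ∃ c : ℝ, 0 < c ∧
      ¬ SetCoverHardness.HasPolyTimeApprox (fun m : ℕ => (m : ℝ) ^ c) :=
  SetCoverHardness.not_hasPolyTimeApprox hETH hPGC
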